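/- Theorem 6.2. Conventions. Fix a field $K$. A finite graph $E=(E^0,E^1,s,r)$ is a directed graph with finite vertex set $E^0$ and finite edge set $E^1$ (loops and multiple edges allowed), with source and range maps $s,r:E^1\to E^0$; it has no sinks if every vertex is the source of some edge. Its adjacency matrix $A_E\in\mathbb N^{E^0\times E^0}$ has $(u,v)$ entry the number of edges from $u$ to $v$. The Leavitt path algebra $\mathcal L(E)$ is the $K$-algebra generated by elements $v$ ($v\in E^0$), $\alpha,\alpha^*$ ($\alpha\in E^1$) subject to $vw=\delta_{vw}v$; $s(\alpha)\alpha=\alpha r(\alpha)=\alpha$ and $r(\alpha)\alpha^*=\alpha^*s(\alpha)=\alpha^*$; $\alpha^*\beta=\delta_{\alpha\beta}r(\alpha)$; and $\sum_{s(\alpha)=v}\alpha\alpha^*=v$ for every $v$ that is not a sink. It is unital with $1=\sum_{v\in E^0}v$, and is $\mathbb Z$-graded by $\deg v=0$, $\deg\alpha=1$, $\deg\alpha^*=-1$. For a $\mathbb Z$-graded ring $A$, let $\mathcal V^{\mathrm{gr}}(A)$ be the commutative monoid, under direct sum, of graded isomorphism classes $[P]$ of graded finitely generated projective right $A$-modules.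 The graded Grothendieck group $K_0^{\mathrm{gr}}(A)$ is the group completion of $\mathcal V^{\mathrm{gr}}(A)$. It is a $\mathbb Z[x,x^{-1}]$-module by $x^n[P]=[P(n)]$, where $P(n)_i=P_{i+n}$, and it is pre-ordered with positive cone $K_0^{\mathrm{gr}}(A)_+$, the image of $\mathcal V^{\mathrm{gr}}(A)$. Given two such pre-ordered modules $G_1,G_2$ with cones $G_1^+,G_2^+$, the group $G_1\otimes_{\mathbb Z}G_2$ is a $\mathbb Z[x,x^{-1}]$-module by the diagonal action $x(g_1\otimes g_2)=xg_1\otimes xg_2$, and is pre-ordered with positive cone the set of finite sums of elements $g_1\otimes g_2$ with $g_1\in G_1^+$, $g_2\in G_2^+$. Theorem. Let $E$ and $F$ be finite graphs with no sinks, and let $E\otimes F$ be the graph with vertex set $E^0\times F^0$ whose adjacency matrix is the Kronecker product $A_E\otimes A_F$. Then there is a $\mathbb Z[x,x^{-1}]$-module isomorphism $$\Phi: K_0^{\mathrm{gr}}(\mathcal L(E\otimes F))\longrightarrow K_0^{\mathrm{gr}}(\mathcal L(E))\otimes_{\mathbb Z}K_0^{\mathrm{gr}}(\mathcal L(F))$$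 that is an isomorphism of pre-ordered groups (an element $z$ lies in the positive cone of the left side if and only if $\Phi(z)$ lies in the positive cone of the right side), and $\Phi([\mathcal L(E\otimes F)])=[\mathcal L(E)]\otimes[\mathcal L(F)]$. -/

import Mathlib

open scoped DirectSum TensorProduct LaurentPolynomial Kronecker

noncomputable section

/-! ### Directed graphs -/

/-- A directed graph with vertex set `V` and edge set `E` (loops and multiple edges allowed). -/
structure DirGraph (V : Type*) (E : Type*) where
  src : E → V
  tgt : E → V

namespace DirGraph

/-- Every vertex emits at least one edge. -/
def NoSinks {V E : Type*} (G : DirGraph V E) : Prop := ∀ v, ∃ e, G.src e = v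

/-- The adjacency matrix: the `(u, v)` entry is the number of edges from `u` to `v`. -/
def adjMatrix {V E : Type*} [DecidableEq V] [Fintype E] (G : DirGraph V E) : Matrix V V ℕ :=
  Matrix.of fun u v => Fintype.card {e : E // G.src e = u ∧ G.tgt e = v}

/-- The edges of the graph of a matrix `A`: there are `A u v` edges from `u` to `v`. -/
abbrev MatrixEdge {V : Type*} (A : Matrix V V ℕ) : Type _ := Σ p : V × V, Fin (A p.1 p.2)

/-- The graph associated to a square matrix of natural numbers. -/
def ofMatrix {V : Type*} (A : Matrix V V ℕ) : DirGraph V (MatrixEdge A) where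
  src e := e.1.1
  tgt e := e.1.2

/-- The graph associated to `A` has adjacency matrix `A`. -/
theorem adjMatrix_ofMatrix {V : Type*} [DecidableEq V] [Fintype V] (A : Matrix V V ℕ) :
    (ofMatrix A).adjMatrix = A := by
  ext u v
  have e : {e : MatrixEdge A // (ofMatrix A).src e = u ∧ (ofMatrix A).tgt e = v} ≃
      Fin (A u v) :=
    { toFun := fun x => Fin.cast (congrArg₂ A x.2.1 x.2.2) x.1.2
      invFun := fun i => ⟨⟨(u, v), i⟩, rfl, rfl⟩
      left_inv := by
        rintro ⟨⟨⟨a, b⟩, i⟩, h1, h2⟩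
        cases h1
        cases h2
        rfl
      right_inv := fun i => rfl }
  simp only [adjMatrix, Matrix.of_apply]
  rw [Fintype.card_congr e, Fintype.card_fin]

/-- The product `G ⊗ H` of two graphs: the graph on `V × W` whose adjacency matrix is the
Kronecker product of the adjacency matrices. -/
def tensor {V E W F : Type*} [DecidableEq V] [Fintype E] [DecidableEq W] [Fintype F]
    (G : DirGraph V E) (H : DirGraph W F) :
    DirGraph (V × W) (MatrixEdge (G.adjMatrix ⊗ₖ H.adjMatrix)) :=
  ofMatrix (G.adjMatrix ⊗ₖ H.adjMatrix)

end DirGraph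

/-! ### Leavitt path algebras of finite graphs -/

namespace Leavitt

/-- Generators: vertices, edges and ghost edges. -/
inductive Gen (V : Type*) (E : Type*)
  | vertex (v : V)
  | edge (e : E)
  | ghost (e : E)

/-- The standard degrees of the generators. -/
def Gen.deg {V E : Type*} : Gen V E → ℤ
  | .vertex _ => 0
  | .edge _ => 1
  | .ghost _ => -1

section

variable (K : Type*) [Field K] {V E : Type*} [DecidableEq V] [Fintype V] [Fintype E]
  (G : DirGraph V E)

/-- The free algebra on the generators, in which the relations are written. -/
abbrev Free (K : Type*) [Field K] (V E : Type*) : Type _ := FreeAlgebra K (Gen V E)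

/-- The generators, in the free algebra. -/
abbrev fv (v : V) : Free K V E := FreeAlgebra.ι K (Gen.vertex v)
/-- The generators, in the free algebra. -/
abbrev fe (e : E) : Free K V E := FreeAlgebra.ι K (Gen.edge e)
/-- The generators, in the free algebra. -/
abbrev fg (e : E) : Free K V E := FreeAlgebra.ι K (Gen.ghost e)

/-- The defining relations of the Leavitt path algebra of a finite graph. The free algebra used
here is unital, so the relation `one`, that the sum of the vertices (which is the identity of the
Leavitt path algebra of a finite graph) is `1`, is included. -/
inductive Rel : Free K V E → Free K V E → Prop
  | vertex_mul_self (v : V) : Rel (fv K v * fv K v) (fv K v)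
  | vertex_mul_ne (v w : V) (h : v ≠ w) : Rel (fv K v * fv K w) 0
  | src_mul_edge (e : E) : Rel (fv K (G.src e) * fe K e) (fe K e)
  | edge_mul_tgt (e : E) : Rel (fe K e * fv K (G.tgt e)) (fe K e)
  | tgt_mul_ghost (e : E) : Rel (fv K (G.tgt e) * fg K e) (fg K e)
  | ghost_mul_src (e : E) : Rel (fg K e * fv K (G.src e)) (fg K e)
  | ghost_mul_edge_self (e : E) : Rel (fg K e * fe K e) (fv K (G.tgt e))
  | ghost_mul_edge_ne (e f : E) (h : e ≠ f) : Rel (fg K e * fe K f) 0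
  | sum_edge_mul_ghost (v : V) (h : ∃ e, G.src e = v) :
      Rel (∑ e ∈ Finset.univ.filter (fun e => G.src e = v), fe K e * fg K e) (fv K v)
  | one : Rel (∑ v : V, fv K v) 1

end

end Leavitt

open Leavitt in
/-- The Leavitt path algebra of a finite graph over a field `K`. -/
def LeavittPathAlgebra (K : Type*) [Field K] {V E : Type*} [DecidableEq V] [Fintype V] [Fintype E]
    (G : DirGraph V E) : Type _ := RingQuot (Rel K G)

namespace LeavittPathAlgebra

open Leavitt

variable (K : Type*) [Field K] {V E : Type*} [DecidableEq V] [Fintype V] [Fintype E]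
  (G : DirGraph V E)

instance : Ring (LeavittPathAlgebra K G) := inferInstanceAs (Ring (RingQuot (Rel K G)))

instance : Algebra K (LeavittPathAlgebra K G) :=
  inferInstanceAs (Algebra K (RingQuot (Rel K G)))

/-- The quotient map from the free algebra. -/
def mk : Free K V E →ₐ[K] LeavittPathAlgebra K G := RingQuot.mkAlgHom K (Rel K G)

theorem mk_rel {a b : Free K V E} (h : Rel K G a b) : mk K G a = mk K G b :=
  RingQuot.mkAlgHom_rel K h

/-- The image of a generator in the Leavitt path algebra. -/
def gen (g : Gen V E) : LeavittPathAlgebra K G := mk K G (FreeAlgebra.ι K g)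

/-- The homogeneous component of degree `n` in the standard `ℤ`-grading: the span of the words of
degree `n` in the generators, where vertices have degree `0`, edges `1` and ghost edges `-1`. -/
def grading (n : ℤ) : Submodule K (LeavittPathAlgebra K G) :=
  Submodule.span K
    {a | ∃ w : List (Gen V E), (w.map Gen.deg).sum = n ∧ (w.map (gen K G)).prod = a}

theorem word_mem (w : List (Gen V E)) :
    (w.map (gen K G)).prod ∈ grading K G (w.map Gen.deg).sum :=
  Submodule.subset_span ⟨w, rfl, rfl⟩

theorem gen_mem (g : Gen V E) : gen K G g ∈ grading K G g.deg := by
  simpa using word_mem K G [g]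

instance : SetLike.GradedMonoid (grading K G) where
  one_mem := by simpa using word_mem K G []
  mul_mem := by
    intro i j a b ha hb
    have h : ∀ x ∈ (grading K G i) * (grading K G j), x ∈ grading K G (i + j) := by
      intro x hx
      rw [grading, grading, Submodule.span_mul_span] at hx
      refine Submodule.span_le.2 ?_ hx
      rintro _ ⟨_, ⟨w, rfl, rfl⟩, _, ⟨w', rfl, rfl⟩, rfl⟩
      simpa using word_mem K G (w ++ w')
    exact h _ (Submodule.mul_mem_mul ha hb)

/-- A generator, as a homogeneous element of the direct sum of the components. -/
def dsGen (g : Gen V E) : ⨁ n, grading K G n :=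
  DirectSum.of (fun n => grading K G n) g.deg ⟨gen K G g, gen_mem K G g⟩

theorem of_eq_of {i j : ℤ} (h : i = j) {a b : LeavittPathAlgebra K G} (hab : a = b)
    (ha : a ∈ grading K G i) (hb : b ∈ grading K G j) :
    DirectSum.of (fun n => grading K G n) i ⟨a, ha⟩ =
      DirectSum.of (fun n => grading K G n) j ⟨b, hb⟩ := by
  subst h
  subst hab
  rfl

theorem sum_of {ι : Type*} {n : ℤ} (s : Finset ι) (x : ι → LeavittPathAlgebra K G)
    (hx : ∀ i, x i ∈ grading K G n) :
    ∑ i ∈ s, DirectSum.of (fun n => grading K G n) n ⟨x i, hx i⟩ =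
      DirectSum.of (fun n => grading K G n) n ⟨∑ i ∈ s, x i, sum_mem fun i _ => hx i⟩ := by
  rw [← map_sum]
  exact congrArg _ (Subtype.ext (AddSubmonoidClass.coe_finsetSum _ _))

theorem edge_mul_ghost_mem (e : E) : gen K G (.edge e) * gen K G (.ghost e) ∈ grading K G 0 := by
  simpa [Gen.deg] using word_mem K G [.edge e, .ghost e]

theorem dsGen_mul (g h : Gen V E) : dsGen K G g * dsGen K G h =
    DirectSum.of (fun n => grading K G n) (g.deg + h.deg)
      ⟨gen K G g * gen K G h, SetLike.mul_mem_graded (gen_mem K G g) (gen_mem K G h)⟩ := by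
  rw [dsGen, dsGen, DirectSum.of_mul_of]
  rfl

theorem lift_rel {a b : Free K V E} (h : Rel K G a b) :
    FreeAlgebra.lift K (dsGen K G) a = FreeAlgebra.lift K (dsGen K G) b := by
  have hr := mk_rel K G h
  cases h <;> simp only [map_mul, map_sum, map_one, map_zero, FreeAlgebra.lift_ι_apply] at hr ⊢ <;>
    try simp only [dsGen_mul]
  case vertex_mul_self => exact of_eq_of K G (by simp [Gen.deg]) hr _ _
  case src_mul_edge => exact of_eq_of K G (by simp [Gen.deg]) hr _ _
  case edge_mul_tgt => exact of_eq_of K G (by simp [Gen.deg]) hr _ _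
  case tgt_mul_ghost => exact of_eq_of K G (by simp [Gen.deg]) hr _ _
  case ghost_mul_src => exact of_eq_of K G (by simp [Gen.deg]) hr _ _
  case ghost_mul_edge_self => exact of_eq_of K G (by simp [Gen.deg]) hr _ _
  case vertex_mul_ne =>
    exact (of_eq_of K G rfl hr _ (zero_mem _)).trans (map_zero _)
  case ghost_mul_edge_ne =>
    exact (of_eq_of K G rfl hr _ (zero_mem _)).trans (map_zero _)
  case sum_edge_mul_ghost v h =>
    refine (Finset.sum_congr rfl fun e _ => of_eq_of K G (show _ = (0 : ℤ) by simp [Gen.deg]) rfl _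
      (edge_mul_ghost_mem K G e)).trans ?_
    exact (sum_of K G _ _ fun e => edge_mul_ghost_mem K G e).trans (of_eq_of K G rfl hr _ _)
  case one =>
    exact (sum_of K G _ _ fun v => gen_mem K G (.vertex v)).trans (of_eq_of K G rfl hr _ _)

/-- The algebra map which decomposes an element into its homogeneous components. -/
def decomposeHom : LeavittPathAlgebra K G →ₐ[K] ⨁ n, grading K G n :=
  RingQuot.liftAlgHom K ⟨FreeAlgebra.lift K (dsGen K G), fun _ _ h => lift_rel K G h⟩

theorem decomposeHom_gen (g : Gen V E) : decomposeHom K G (gen K G g) = dsGen K G g := by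
  have := RingQuot.liftAlgHom_mkAlgHom_apply K (FreeAlgebra.lift K (dsGen K G))
    (fun _ _ h => lift_rel K G h) (FreeAlgebra.ι K g)
  exact this.trans (by simp)

theorem decomposeHom_word (w : List (Gen V E)) :
    decomposeHom K G (w.map (gen K G)).prod =
      DirectSum.of (fun n => grading K G n) (w.map Gen.deg).sum ⟨_, word_mem K G w⟩ := by
  induction w with
  | nil => exact map_one (decomposeHom K G)
  | cons g w ih =>
    simp only [List.map_cons, List.prod_cons, map_mul, ih, decomposeHom_gen]
    rw [dsGen, DirectSum.of_mul_of]
    exact of_eq_of K G (by simp) rfl _ _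

/-- The Leavitt path algebra is a `ℤ`-graded algebra. -/
instance : GradedAlgebra (grading K G) :=
  GradedAlgebra.ofAlgHom _ (decomposeHom K G)
    (by
      refine RingQuot.ringQuot_ext' _ _ _ ?_
      refine FreeAlgebra.hom_ext ?_
      funext g
      change DirectSum.coeAlgHom _ (decomposeHom K G (gen K G g)) = gen K G g
      rw [decomposeHom_gen, dsGen]
      exact DirectSum.coeAlgHom_of _ _ _)
    (by
      rintro n ⟨x, hx⟩
      refine Submodule.span_induction
        (p := fun y hy => decomposeHom K G y =
          DirectSum.of (fun n => grading K G n) n ⟨y, hy⟩) ?_ ?_ ?_ ?_ hx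
      · rintro _ ⟨w, rfl, rfl⟩
        exact decomposeHom_word K G w
      · rw [map_zero]
        exact (map_zero (DirectSum.of (fun n => grading K G n) n)).symm
      · intro y z hy hz h1 h2
        rw [map_add, h1, h2]
        exact (map_add (DirectSum.of (fun n => grading K G n) n) ⟨y, hy⟩ ⟨z, hz⟩).symm
      · intro c y hy h
        rw [map_smul, h]
        exact ((DirectSum.lof K ℤ (fun n => grading K G n) n).map_smul c ⟨y, hy⟩).symm)

end LeavittPathAlgebra

/-! ### Graded finitely generated projective right modules -/

universe u v

/-- A graded finitely generated projective right module over a `ℤ`-graded algebra `A`; right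
`A`-modules are modules over the opposite ring, so that `MulOpposite.op a • m` is `m a`. -/
structure GrProj {K : Type v} {A : Type u} [Field K] [Ring A] [Algebra K A]
    (𝒜 : ℤ → Submodule K A) where
  carrier : Type u
  [addCommGroup : AddCommGroup carrier]
  [module : Module Aᵐᵒᵖ carrier]
  /-- The homogeneous components. -/
  comp : ℤ → AddSubgroup carrier
  internal : DirectSum.IsInternal comp
  smul_mem : ∀ (i j : ℤ) (m : carrier) (a : A), m ∈ comp i → a ∈ 𝒜 j →
    MulOpposite.op a • m ∈ comp (i + j)
  finite : Module.Finite Aᵐᵒᵖ carrier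
  projective : Module.Projective Aᵐᵒᵖ carrier

theorem isInternal_iff {M : Type*} [AddCommGroup M] (ℳ : ℤ → AddSubgroup M) :
    DirectSum.IsInternal ℳ ↔ iSupIndep ℳ ∧ iSup ℳ = ⊤ := by
  have h1 : DirectSum.IsInternal ℳ ↔
      DirectSum.IsInternal (fun i => AddSubgroup.toIntSubmodule (ℳ i)) := Iff.rfl
  rw [h1, DirectSum.isInternal_submodule_iff_iSupIndep_and_iSup_eq_top]
  refine and_congr (iSupIndep_map_orderIso_iff (AddSubgroup.toIntSubmodule (M := M))) ?_
  rw [← OrderIso.map_iSup, map_eq_top_iff]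

theorem isInternal_shift {M : Type*} [AddCommGroup M] (ℳ : ℤ → AddSubgroup M)
    (h : DirectSum.IsInternal ℳ) (n : ℤ) : DirectSum.IsInternal (fun i => ℳ (i + n)) := by
  rw [isInternal_iff] at h ⊢
  refine ⟨h.1.comp (add_left_injective n), ?_⟩
  rw [← h.2]
  exact (Equiv.addRight n).iSup_comp (g := ℳ)

theorem isInternal_prod {M N : Type*} [AddCommGroup M] [AddCommGroup N]
    (ℳ : ℤ → AddSubgroup M) (𝒩 : ℤ → AddSubgroup N)
    (hM : DirectSum.IsInternal ℳ) (hN : DirectSum.IsInternal 𝒩) :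
    DirectSum.IsInternal (fun i => (ℳ i).prod (𝒩 i)) := by
  let p₁ : ∀ i, (ℳ i).prod (𝒩 i) →+ ℳ i := fun i =>
    { toFun := fun x => ⟨x.1.1, x.2.1⟩, map_zero' := rfl, map_add' := fun _ _ => rfl }
  let p₂ : ∀ i, (ℳ i).prod (𝒩 i) →+ 𝒩 i := fun i =>
    { toFun := fun x => ⟨x.1.2, x.2.2⟩, map_zero' := rfl, map_add' := fun _ _ => rfl }
  let j₁ : ∀ i, ℳ i →+ (ℳ i).prod (𝒩 i) := fun i =>
    { toFun := fun x => ⟨(x.1, 0), x.2, zero_mem _⟩, map_zero' := rfl,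
      map_add' := fun _ _ => Subtype.ext (Prod.ext rfl (add_zero _).symm) }
  let j₂ : ∀ i, 𝒩 i →+ (ℳ i).prod (𝒩 i) := fun i =>
    { toFun := fun x => ⟨(0, x.1), zero_mem _, x.2⟩, map_zero' := rfl,
      map_add' := fun _ _ => Subtype.ext (Prod.ext (add_zero _).symm rfl) }
  let c := DirectSum.coeAddMonoidHom (fun i => (ℳ i).prod (𝒩 i))
  have e₁ : (DirectSum.coeAddMonoidHom ℳ).comp (DirectSum.map p₁) =
      (AddMonoidHom.fst M N).comp c := by
    ext i x
    simp [c, p₁]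
  have e₂ : (DirectSum.coeAddMonoidHom 𝒩).comp (DirectSum.map p₂) =
      (AddMonoidHom.snd M N).comp c := by
    ext i x
    simp [c, p₂]
  have f₁ : c.comp (DirectSum.map j₁) =
      (AddMonoidHom.inl M N).comp (DirectSum.coeAddMonoidHom ℳ) := by
    ext i x <;> simp [c, j₁]
  have f₂ : c.comp (DirectSum.map j₂) =
      (AddMonoidHom.inr M N).comp (DirectSum.coeAddMonoidHom 𝒩) := by
    ext i x <;> simp [c, j₂]
  constructor
  · refine (injective_iff_map_eq_zero c).2 fun x hx => ?_
    have h₁ : DirectSum.map p₁ x = 0 := by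
      refine (injective_iff_map_eq_zero _).1 hM.1 _ ?_
      exact (DFunLike.congr_fun e₁ x).trans (congrArg Prod.fst hx)
    have h₂ : DirectSum.map p₂ x = 0 := by
      refine (injective_iff_map_eq_zero _).1 hN.1 _ ?_
      exact (DFunLike.congr_fun e₂ x).trans (congrArg Prod.snd hx)
    refine DFinsupp.ext fun i => Subtype.ext (Prod.ext ?_ ?_)
    · have := congrArg Subtype.val (DFunLike.congr_fun h₁ i)
      rwa [DirectSum.map_apply] at this
    · have := congrArg Subtype.val (DFunLike.congr_fun h₂ i)
      rwa [DirectSum.map_apply] at this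
  · rintro ⟨m, n⟩
    obtain ⟨x, rfl⟩ := hM.2 m
    obtain ⟨y, rfl⟩ := hN.2 n
    refine ⟨DirectSum.map j₁ x + DirectSum.map j₂ y, ?_⟩
    change c _ = _
    rw [map_add]
    have h₁ := DFunLike.congr_fun f₁ x
    have h₂ := DFunLike.congr_fun f₂ y
    simp only [AddMonoidHom.comp_apply] at h₁ h₂
    rw [h₁, h₂]
    simp

namespace GrProj

attribute [instance] addCommGroup module

variable {K : Type v} {A : Type u} [Field K] [Ring A] [Algebra K A] {𝒜 : ℤ → Submodule K A}

/-- Graded isomorphism: an isomorphism of right modules which matches the components. -/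
def Iso (M N : GrProj 𝒜) : Prop :=
  ∃ f : M.carrier ≃ₗ[Aᵐᵒᵖ] N.carrier, ∀ i m, m ∈ M.comp i ↔ f m ∈ N.comp i

instance setoid (𝒜 : ℤ → Submodule K A) : Setoid (GrProj 𝒜) where
  r := Iso
  iseqv :=
    { refl := fun _ => ⟨LinearEquiv.refl _ _, fun _ _ => Iff.rfl⟩
      symm := fun ⟨f, hf⟩ => ⟨f.symm, fun i m => by rw [hf, LinearEquiv.apply_symm_apply]⟩
      trans := fun ⟨f, hf⟩ ⟨g, hg⟩ => ⟨f.trans g, fun i m => (hf i m).trans (hg i (f m))⟩ }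

/-- The direct sum of two graded modules. -/
def add (M N : GrProj 𝒜) : GrProj 𝒜 where
  carrier := M.carrier × N.carrier
  comp i := (M.comp i).prod (N.comp i)
  internal := isInternal_prod _ _ M.internal N.internal
  smul_mem i j m a hm ha := ⟨M.smul_mem i j m.1 a hm.1 ha, N.smul_mem i j m.2 a hm.2 ha⟩
  finite := by
    have := M.finite
    have := N.finite
    infer_instance
  projective := by
    have := M.projective
    have := N.projective
    infer_instance

/-- The zero module. -/
def zero : GrProj 𝒜 where
  carrier := PUnit
  comp _ := ⊤
  internal := ⟨fun _ _ _ => DFinsupp.ext fun _ => Subsingleton.elim _ _,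
    fun x => ⟨DirectSum.of _ 0 ⟨x, trivial⟩, Subsingleton.elim _ _⟩⟩
  smul_mem _ _ _ _ _ _ := AddSubgroup.mem_top _
  finite := inferInstance
  projective := inferInstance

/-- The shifted module `M(n)`, with `M(n)_i = M_{i + n}`. -/
def shift (n : ℤ) (M : GrProj 𝒜) : GrProj 𝒜 where
  carrier := M.carrier
  comp i := M.comp (i + n)
  internal := isInternal_shift M.comp M.internal n
  smul_mem i j m a hm ha := by
    have := M.smul_mem (i + n) j m a hm ha
    rwa [add_right_comm] at this
  finite := M.finite
  projective := M.projective

/-- A ring, as a right module over itself, is free of rank one. -/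
def regularEquiv (A : Type u) [Ring A] : Aᵐᵒᵖ ≃ₗ[Aᵐᵒᵖ] A where
  toFun := MulOpposite.unop
  invFun := MulOpposite.op
  map_add' _ _ := rfl
  map_smul' _ _ := rfl
  left_inv _ := rfl
  right_inv _ := rfl

/-- The ring `A` as a graded right module over itself. -/
def regular (𝒜 : ℤ → Submodule K A) [GradedAlgebra 𝒜] : GrProj 𝒜 where
  carrier := A
  comp i := (𝒜 i).toAddSubgroup
  internal := DirectSum.Decomposition.isInternal 𝒜
  smul_mem _ _ _ _ hm ha := SetLike.GradedMul.mul_mem (A := 𝒜) hm ha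
  finite := Module.Finite.equiv (regularEquiv A)
  projective := Module.Projective.of_equiv (regularEquiv A)

end GrProj

/-- The monoid `𝒱^gr(A)` of graded isomorphism classes of graded finitely generated projective
right `A`-modules. -/
def VGr {K : Type v} {A : Type u} [Field K] [Ring A] [Algebra K A] (𝒜 : ℤ → Submodule K A) :
    Type (u + 1) := Quotient (GrProj.setoid 𝒜)

namespace VGr

variable {K : Type v} {A : Type u} [Field K] [Ring A] [Algebra K A] {𝒜 : ℤ → Submodule K A}

/-- The class of a graded finitely generated projective module. -/
def mk (M : GrProj 𝒜) : VGr 𝒜 := Quotient.mk _ M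

theorem mk_eq {M N : GrProj 𝒜} (f : M.carrier ≃ₗ[Aᵐᵒᵖ] N.carrier)
    (hf : ∀ i m, m ∈ M.comp i ↔ f m ∈ N.comp i) : mk M = mk N := Quotient.sound ⟨f, hf⟩

/-- Addition is induced by the direct sum. -/
instance : Add (VGr 𝒜) where
  add := Quotient.map₂ GrProj.add (by
    rintro M M' ⟨f, hf⟩ N N' ⟨g, hg⟩
    exact ⟨f.prodCongr g, fun i m => and_congr (hf i m.1) (hg i m.2)⟩)

instance : Zero (VGr 𝒜) := ⟨mk GrProj.zero⟩

theorem mk_add (M N : GrProj 𝒜) : mk M + mk N = mk (M.add N) := rfl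

instance : AddCommMonoid (VGr 𝒜) where
  add_assoc := by
    rintro ⟨M⟩ ⟨N⟩ ⟨P⟩
    exact mk_eq (LinearEquiv.prodAssoc Aᵐᵒᵖ M.carrier N.carrier P.carrier) fun i m => and_assoc
  zero_add := by
    rintro ⟨M⟩
    let f : (PUnit.{u + 1} × M.carrier) ≃ₗ[Aᵐᵒᵖ] M.carrier := LinearEquiv.uniqueProd
    exact mk_eq (M := GrProj.zero.add M) f fun i m => ⟨fun h => h.2, fun h => ⟨trivial, h⟩⟩
  add_zero := by
    rintro ⟨M⟩
    let f : (M.carrier × PUnit.{u + 1}) ≃ₗ[Aᵐᵒᵖ] M.carrier := LinearEquiv.prodUnique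
    exact mk_eq (M := M.add GrProj.zero) f fun i m => ⟨fun h => h.1, fun h => ⟨h, trivial⟩⟩
  add_comm := by
    rintro ⟨M⟩ ⟨N⟩
    exact mk_eq (M := M.add N) (N := N.add M)
      (LinearEquiv.prodComm Aᵐᵒᵖ M.carrier N.carrier) fun i m => and_comm
  nsmul := nsmulRec

/-- The shift `[P] ↦ [P(n)]`. -/
def shift (n : ℤ) : VGr 𝒜 →+ VGr 𝒜 where
  toFun := Quotient.map (GrProj.shift n) (by
    rintro M N ⟨f, hf⟩
    exact ⟨f, fun i m => hf (i + n) m⟩)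
  map_zero' := rfl
  map_add' := by
    rintro ⟨M⟩ ⟨N⟩
    rfl

theorem shift_mk (n : ℤ) (M : GrProj 𝒜) : shift n (mk M) = mk (M.shift n) := rfl

/-- The action of `ℤ` on `𝒱^gr(A)` by shifts. -/
def shiftHom (𝒜 : ℤ → Submodule K A) : Multiplicative ℤ →* AddMonoid.End (VGr 𝒜) where
  toFun n := shift n.toAdd
  map_one' := by
    ext ⟨M⟩
    refine mk_eq (M := M.shift 0) (N := M) (LinearEquiv.refl _ _) fun i m => ?_
    change m ∈ M.comp (i + 0) ↔ m ∈ M.comp i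
    rw [add_zero]
  map_mul' a b := by
    ext ⟨M⟩
    refine mk_eq (M := M.shift (a.toAdd + b.toAdd)) (N := (M.shift b.toAdd).shift a.toAdd)
      (LinearEquiv.refl _ _) fun i m => ?_
    change m ∈ M.comp (i + (a.toAdd + b.toAdd)) ↔ m ∈ M.comp (i + a.toAdd + b.toAdd)
    rw [add_assoc]

end VGr

/-! ### `ℤ[x, x⁻¹]`-modules -/

/-- The `ℤ[x, x⁻¹]`-module structure on an abelian group with an action of `ℤ` by automorphisms:
`x ^ n` acts as `ρ n`. -/
@[reducible]
def laurentModule {G : Type*} [AddCommGroup G] (ρ : Multiplicative ℤ →* AddMonoid.End G) :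
    Module ℤ[T;T⁻¹] G :=
  Module.compHom G (AddMonoidAlgebra.lift ℤ (AddMonoid.End G) ℤ ρ).toRingHom

theorem laurentModule_T_smul {G : Type*} [AddCommGroup G]
    (ρ : Multiplicative ℤ →* AddMonoid.End G) (n : ℤ) (g : G) :
    letI := laurentModule ρ
    (LaurentPolynomial.T n : ℤ[T;T⁻¹]) • g = ρ (Multiplicative.ofAdd n) g := by
  change AddMonoidAlgebra.lift ℤ (AddMonoid.End G) ℤ ρ (AddMonoidAlgebra.single n 1) g = _
  rw [AddMonoidAlgebra.lift_single, one_smul]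

/-! ### The graded Grothendieck group -/

/-- The graded Grothendieck group `K₀^gr(A)`, the group completion of `𝒱^gr(A)`. -/
def K0gr {K : Type v} {A : Type u} [Field K] [Ring A] [Algebra K A] (𝒜 : ℤ → Submodule K A) :
    Type (u + 1) := Algebra.GrothendieckAddGroup (VGr 𝒜)

namespace K0gr

variable {K : Type v} {A : Type u} [Field K] [Ring A] [Algebra K A] (𝒜 : ℤ → Submodule K A)

instance : AddCommGroup (K0gr 𝒜) :=
  inferInstanceAs (AddCommGroup (Algebra.GrothendieckAddGroup (VGr 𝒜)))

/-- The natural map `𝒱^gr(A) → K₀^gr(A)`. -/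
def of : VGr 𝒜 →+ K0gr 𝒜 := Algebra.GrothendieckAddGroup.of

/-- The class of a graded finitely generated projective module. -/
def cls {𝒜 : ℤ → Submodule K A} (M : GrProj 𝒜) : K0gr 𝒜 := of 𝒜 (VGr.mk M)

theorem hom_ext {H : Type*} [AddCommGroup H] {f g : K0gr 𝒜 →+ H}
    (h : ∀ v, f (of 𝒜 v) = g (of 𝒜 v)) : f = g :=
  Algebra.GrothendieckAddGroup.lift.symm.injective (AddMonoidHom.ext h)

/-- The endomorphism of the group completion induced by an endomorphism of the monoid. -/
def map (f : AddMonoid.End (VGr 𝒜)) : AddMonoid.End (K0gr 𝒜) :=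
  Algebra.GrothendieckAddGroup.lift ((of 𝒜).comp f)

theorem map_of (f : AddMonoid.End (VGr 𝒜)) (v : VGr 𝒜) : map 𝒜 f (of 𝒜 v) = of 𝒜 (f v) :=
  DFunLike.congr_fun
    (Algebra.GrothendieckAddGroup.lift.symm_apply_apply ((of 𝒜).comp f)) v

/-- The action of `ℤ` on `K₀^gr(A)` by shifts. -/
def shiftHom : Multiplicative ℤ →* AddMonoid.End (K0gr 𝒜) where
  toFun n := map 𝒜 (VGr.shiftHom 𝒜 n)
  map_one' := hom_ext 𝒜 fun v =>
    (map_of 𝒜 _ v).trans (by rw [map_one]; rfl)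
  map_mul' a b := hom_ext 𝒜 fun v => by
    have h : map 𝒜 (VGr.shiftHom 𝒜 a) (map 𝒜 (VGr.shiftHom 𝒜 b) (of 𝒜 v)) =
        of 𝒜 (VGr.shiftHom 𝒜 a (VGr.shiftHom 𝒜 b v)) := by
      rw [map_of, map_of]
    refine (map_of 𝒜 _ v).trans (Eq.trans ?_ h.symm)
    rw [map_mul]
    rfl

instance : Module ℤ[T;T⁻¹] (K0gr 𝒜) := laurentModule (shiftHom 𝒜)

/-- The module structure is given by `x ^ n [P] = [P(n)]`. -/
theorem T_smul_cls (n : ℤ) (M : GrProj 𝒜) :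
    (LaurentPolynomial.T n : ℤ[T;T⁻¹]) • cls M = cls (M.shift n) :=
  (laurentModule_T_smul (shiftHom 𝒜) n (cls M)).trans (map_of 𝒜 _ _)

/-- The positive cone `K₀^gr(A)₊`: the image of `𝒱^gr(A)`. -/
def cone : AddSubmonoid (K0gr 𝒜) := AddMonoidHom.mrange (of 𝒜)

end K0gr

/-! ### Tensor products with the diagonal action -/

/-- The tensor product over `ℤ` of two `ℤ[x, x⁻¹]`-modules; it carries the diagonal action of `x`
(as opposed to the action on one of the two factors). -/
def DiagTensor (G : Type*) (H : Type*) [AddCommGroup G] [AddCommGroup H] : Type _ := G ⊗[ℤ] H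

namespace DiagTensor

variable (G : Type*) (H : Type*) [AddCommGroup G] [AddCommGroup H]

instance : AddCommGroup (DiagTensor G H) := inferInstanceAs (AddCommGroup (G ⊗[ℤ] H))

variable {G H} in
/-- Pure tensors. -/
def tmul (g : G) (h : H) : DiagTensor G H := g ⊗ₜ[ℤ] h

variable [Module ℤ[T;T⁻¹] G] [Module ℤ[T;T⁻¹] H]

/-- Multiplication by `p`, as a `ℤ`-linear map. -/
def mulMap (G : Type*) [AddCommGroup G] [Module ℤ[T;T⁻¹] G] (p : ℤ[T;T⁻¹]) : G →ₗ[ℤ] G :=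
  (DistribSMul.toAddMonoidHom G p).toIntLinearMap

theorem mulMap_one (G : Type*) [AddCommGroup G] [Module ℤ[T;T⁻¹] G] :
    mulMap G 1 = LinearMap.id := LinearMap.ext fun g => one_smul _ g

theorem mulMap_mul (G : Type*) [AddCommGroup G] [Module ℤ[T;T⁻¹] G] (p q : ℤ[T;T⁻¹]) :
    mulMap G (p * q) = (mulMap G p).comp (mulMap G q) := LinearMap.ext fun g => mul_smul p q g

/-- The diagonal action of `ℤ`: the integer `n` acts by `g ⊗ h ↦ xⁿ g ⊗ xⁿ h`. -/
def diagHom : Multiplicative ℤ →* AddMonoid.End (DiagTensor G H) where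
  toFun n := (TensorProduct.map (mulMap G (LaurentPolynomial.T n.toAdd))
    (mulMap H (LaurentPolynomial.T n.toAdd))).toAddMonoidHom
  map_one' := by
    rw [toAdd_one, LaurentPolynomial.T_zero, mulMap_one, mulMap_one, TensorProduct.map_id]
    rfl
  map_mul' a b := by
    rw [toAdd_mul, LaurentPolynomial.T_add, mulMap_mul, mulMap_mul, TensorProduct.map_comp]
    rfl

instance : Module ℤ[T;T⁻¹] (DiagTensor G H) := laurentModule (diagHom G H)

/-- The action of `x` is diagonal. -/
theorem T_smul_tmul (n : ℤ) (g : G) (h : H) :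
    (LaurentPolynomial.T n : ℤ[T;T⁻¹]) • tmul g h =
      tmul ((LaurentPolynomial.T n : ℤ[T;T⁻¹]) • g) ((LaurentPolynomial.T n : ℤ[T;T⁻¹]) • h) :=
  laurentModule_T_smul (diagHom G H) n (tmul g h)

variable {G H} in
/-- The positive cone of the tensor product: sums of tensors `g ⊗ h` of positive elements. -/
def cone {G : Type*} {H : Type*} [AddCommGroup G] [AddCommGroup H] (C : AddSubmonoid G)
    (D : AddSubmonoid H) : AddSubmonoid (DiagTensor G H) :=
  AddSubmonoid.closure {t | ∃ g ∈ C, ∃ h ∈ D, tmul g h = t}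

end DiagTensor

end

/-! For a finite graph without sinks, the graded Grothendieck group is the dimension group of the
adjacency matrix `A`: the direct limit of `ℤ^V` under `A` acting on row vectors, with `x` acting as
`A`. Dimension groups turn Kronecker products into tensor products, so the theorem splits into this
description and a computation with matrices.

No limit is constructed. `IsDimensionGroup` characterises the dimension group by generators `b v`,
the relations `x b v = ∑ A v w b w`, the cone spanned by the `x ^ n b v`, and the condition that an
integral combination of the `b v` vanishes only if some power of `A` kills its coefficient vector.
These data determine the pre-ordered module (`IsDimensionGroup.exists_linearEquiv`).

On the side of the algebra, every graded finitely generated projective module is a finite direct sum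
of modules `v L`, all shifted by the same degree; a family of generators that exhibits this is a
vertex basis. Since `v = ∑ e e*` over the edges leaving `v`, each `q i` may be replaced by the
elements `q i e`, one degree higher; this push multiplies the vector of vertex multiplicities by
`A`. The degree zero part of `L` is the union of the chain `level n n`, and a push lowers by one the
level of a matrix of degree zero coefficients. After finitely many pushes the coefficients lie in
the span of the vertices and linear algebra over `K` applies. This gives existence of vertex bases
(`exists_vertexBasis`) and uniqueness of multiplicities up to a power of `A`
(`IsVertexBasis.vertexCount_eq`); the latter needs the vertices to be nonzero. As equality in a
group completion is stable isomorphism, `isDimensionGroup` follows.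

For the tensor product the delicate point is the kernel condition. A dimension group is
torsion-free, hence flat over `ℤ`, and the equational criterion for a vanishing sum of tensors
reduces the condition to the two factors (`IsDimensionGroup.tensor_ker`). -/

noncomputable section

namespace LeavittPathAlgebra

open Leavitt

/-! ### Relations in the Leavitt path algebra. -/

section Relations

variable (K : Type*) [Field K] {V E : Type*} [DecidableEq V] [Fintype V] [Fintype E]
  (G : DirGraph V E)

/-- The vertex `v`, as an element of the Leavitt path algebra. -/
abbrev vert (v : V) : LeavittPathAlgebra K G := gen K G (.vertex v)
/-- The edge `e`, as an element of the Leavitt path algebra. -/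
abbrev edge (e : E) : LeavittPathAlgebra K G := gen K G (.edge e)
/-- The ghost edge of `e`, as an element of the Leavitt path algebra. -/
abbrev ghost (e : E) : LeavittPathAlgebra K G := gen K G (.ghost e)

theorem vert_mul_self (v : V) : vert K G v * vert K G v = vert K G v :=
  (map_mul (mk K G) _ _).symm.trans (mk_rel K G (.vertex_mul_self v))

theorem vert_mul_ne {v w : V} (h : v ≠ w) : vert K G v * vert K G w = 0 :=
  ((map_mul (mk K G) _ _).symm.trans (mk_rel K G (.vertex_mul_ne v w h))).trans (map_zero _)

theorem src_mul_edge (e : E) : vert K G (G.src e) * edge K G e = edge K G e :=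
  (map_mul (mk K G) _ _).symm.trans (mk_rel K G (.src_mul_edge e))

theorem edge_mul_tgt (e : E) : edge K G e * vert K G (G.tgt e) = edge K G e :=
  (map_mul (mk K G) _ _).symm.trans (mk_rel K G (.edge_mul_tgt e))

theorem tgt_mul_ghost (e : E) : vert K G (G.tgt e) * ghost K G e = ghost K G e :=
  (map_mul (mk K G) _ _).symm.trans (mk_rel K G (.tgt_mul_ghost e))

theorem ghost_mul_src (e : E) : ghost K G e * vert K G (G.src e) = ghost K G e :=
  (map_mul (mk K G) _ _).symm.trans (mk_rel K G (.ghost_mul_src e))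

theorem ghost_mul_edge_self (e : E) : ghost K G e * edge K G e = vert K G (G.tgt e) :=
  (map_mul (mk K G) _ _).symm.trans (mk_rel K G (.ghost_mul_edge_self e))

theorem ghost_mul_edge_ne {e f : E} (h : e ≠ f) : ghost K G e * edge K G f = 0 :=
  ((map_mul (mk K G) _ _).symm.trans (mk_rel K G (.ghost_mul_edge_ne e f h))).trans (map_zero _)

theorem sum_edge_mul_ghost {v : V} (h : ∃ e, G.src e = v) :
    ∑ e ∈ Finset.univ.filter (fun e => G.src e = v), edge K G e * ghost K G e = vert K G v := by
  have := mk_rel K G (.sum_edge_mul_ghost v h)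
  simp only [map_sum, map_mul] at this
  exact this

theorem sum_vert : ∑ v : V, vert K G v = 1 := by
  have := mk_rel K G (.one (K := K) (G := G))
  simp only [map_sum, map_one] at this
  exact this

theorem vert_mem (v : V) : vert K G v ∈ grading K G 0 := gen_mem K G (.vertex v)
theorem edge_mem (e : E) : edge K G e ∈ grading K G 1 := gen_mem K G (.edge e)

/-! ### The filtration of the degree zero component -/

/-- The span of the vertices. -/
def vertSpan : Submodule K (LeavittPathAlgebra K G) := Submodule.span K (Set.range (vert K G))
/-- The span of the edges. -/
def edgeSpan : Submodule K (LeavittPathAlgebra K G) := Submodule.span K (Set.range (edge K G))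
/-- The span of the ghost edges. -/
def ghostSpan : Submodule K (LeavittPathAlgebra K G) := Submodule.span K (Set.range (ghost K G))

/-- The span of the products `α β*` with `α` a path of length `n` and `β` a path of length `m`. -/
def level (n m : ℕ) : Submodule K (LeavittPathAlgebra K G) :=
  edgeSpan K G ^ n * vertSpan K G * ghostSpan K G ^ m

theorem vertSpan_mul_vertSpan : vertSpan K G * vertSpan K G ≤ vertSpan K G := by
  rw [vertSpan, Submodule.span_mul_span, Submodule.span_le]
  rintro _ ⟨_, ⟨v, rfl⟩, _, ⟨w, rfl⟩, rfl⟩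
  change vert K G v * vert K G w ∈ _
  by_cases h : v = w
  · subst h
    rw [vert_mul_self]
    exact Submodule.subset_span ⟨v, rfl⟩
  · rw [vert_mul_ne K G h]
    exact zero_mem _

theorem vert_mul_edge_mem (v : V) (e : E) : vert K G v * edge K G e ∈ edgeSpan K G := by
  by_cases h : v = G.src e
  · subst h
    rw [src_mul_edge]
    exact Submodule.subset_span ⟨e, rfl⟩
  · rw [← src_mul_edge, ← mul_assoc, vert_mul_ne K G h, zero_mul]
    exact zero_mem _

theorem ghost_mul_vert_mem (e : E) (v : V) : ghost K G e * vert K G v ∈ ghostSpan K G := by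
  by_cases h : G.src e = v
  · subst h
    rw [ghost_mul_src]
    exact Submodule.subset_span ⟨e, rfl⟩
  · rw [← ghost_mul_src, mul_assoc, vert_mul_ne K G h, mul_zero]
    exact zero_mem _

theorem vertSpan_mul_edgeSpan : vertSpan K G * edgeSpan K G ≤ edgeSpan K G := by
  rw [vertSpan, edgeSpan, Submodule.span_mul_span, Submodule.span_le]
  rintro _ ⟨_, ⟨v, rfl⟩, _, ⟨e, rfl⟩, rfl⟩
  exact vert_mul_edge_mem K G v e

theorem ghostSpan_mul_vertSpan : ghostSpan K G * vertSpan K G ≤ ghostSpan K G := by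
  rw [vertSpan, ghostSpan, Submodule.span_mul_span, Submodule.span_le]
  rintro _ ⟨_, ⟨e, rfl⟩, _, ⟨v, rfl⟩, rfl⟩
  exact ghost_mul_vert_mem K G e v

theorem ghostSpan_mul_edgeSpan : ghostSpan K G * edgeSpan K G ≤ vertSpan K G := by
  rw [edgeSpan, ghostSpan, Submodule.span_mul_span, Submodule.span_le]
  rintro _ ⟨_, ⟨e, rfl⟩, _, ⟨f, rfl⟩, rfl⟩
  change ghost K G e * edge K G f ∈ _
  by_cases h : e = f
  · subst h
    rw [ghost_mul_edge_self]
    exact Submodule.subset_span ⟨_, rfl⟩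
  · rw [ghost_mul_edge_ne K G h]
    exact zero_mem _

theorem level_succ_left (n m : ℕ) : level K G (n + 1) m = edgeSpan K G * level K G n m := by
  simp only [level, pow_succ', mul_assoc]

theorem level_succ_right (n m : ℕ) : level K G n (m + 1) = level K G n m * ghostSpan K G := by
  simp only [level, pow_succ, mul_assoc]

theorem vertSpan_mul_level (n m : ℕ) : vertSpan K G * level K G n m ≤ level K G n m := by
  cases n with
  | zero =>
    simp only [level, pow_zero, one_mul]
    rw [← mul_assoc]
    exact mul_le_mul_left (vertSpan_mul_vertSpan K G) _
  | succ n =>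
    rw [level_succ_left, ← mul_assoc]
    exact mul_le_mul_left (vertSpan_mul_edgeSpan K G) _

theorem level_mul_vertSpan (n m : ℕ) : level K G n m * vertSpan K G ≤ level K G n m := by
  cases m with
  | zero =>
    simp only [level, pow_zero, mul_one]
    rw [mul_assoc]
    exact mul_le_mul_right (vertSpan_mul_vertSpan K G) _
  | succ n =>
    rw [level_succ_right, mul_assoc]
    exact mul_le_mul_right (ghostSpan_mul_vertSpan K G) _

theorem ghostSpan_mul_level (n m : ℕ) :
    ghostSpan K G * level K G (n + 1) m ≤ level K G n m := by
  rw [level_succ_left, ← mul_assoc]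
  exact (mul_le_mul_left (ghostSpan_mul_edgeSpan K G) _).trans (vertSpan_mul_level K G n m)

theorem level_mul_edgeSpan (n m : ℕ) :
    level K G n (m + 1) * edgeSpan K G ≤ level K G n m := by
  rw [level_succ_right, mul_assoc]
  exact (mul_le_mul_right (ghostSpan_mul_edgeSpan K G) _).trans (level_mul_vertSpan K G n m)

/-- The ghost edge cancels the first edge of each path `α` and the edge cancels the last ghost edge
of each `β*`. Both inductions on levels, for existence and for uniqueness of vertex bases, rest on
this descent. -/
theorem ghost_mul_level_mul_edge {n : ℕ} {a : LeavittPathAlgebra K G}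
    (ha : a ∈ level K G (n + 1) (n + 1)) (e f : E) :
    ghost K G e * a * edge K G f ∈ level K G n n := by
  refine level_mul_edgeSpan K G n n (Submodule.mul_mem_mul ?_ (Submodule.subset_span ⟨f, rfl⟩))
  exact ghostSpan_mul_level K G n (n + 1)
    (Submodule.mul_mem_mul (Submodule.subset_span ⟨e, rfl⟩) ha)

variable {G}

theorem vertSpan_le_edge_mul_ghost (hG : G.NoSinks) :
    vertSpan K G ≤ edgeSpan K G * (vertSpan K G * ghostSpan K G) := by
  rw [vertSpan, Submodule.span_le]
  rintro _ ⟨v, rfl⟩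
  rw [SetLike.mem_coe, ← sum_edge_mul_ghost K G (hG v)]
  refine sum_mem fun e _ => ?_
  rw [← edge_mul_tgt, mul_assoc]
  exact Submodule.mul_mem_mul (Submodule.subset_span ⟨e, rfl⟩)
    (Submodule.mul_mem_mul (Submodule.subset_span ⟨_, rfl⟩) (Submodule.subset_span ⟨e, rfl⟩))

/-- Each `v` in the middle of `α v β*` is expanded as `∑ e e*`, which requires `v` to emit an edge.
-/
theorem level_le_succ (hG : G.NoSinks) (n m : ℕ) :
    level K G n m ≤ level K G (n + 1) (m + 1) := by
  have h : level K G (n + 1) (m + 1) = edgeSpan K G ^ n *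
      (edgeSpan K G * (vertSpan K G * ghostSpan K G)) * ghostSpan K G ^ m := by
    rw [level, pow_succ, pow_succ']
    simp only [mul_assoc]
  rw [h]
  exact mul_le_mul_left (mul_le_mul_right (vertSpan_le_edge_mul_ghost K hG) _) _

theorem level_diag_mono (hG : G.NoSinks) : Monotone fun n => level K G n n :=
  monotone_nat_of_le_succ fun n => level_le_succ K hG n n

/-- Words are built from the left. A ghost edge needs an edge to cancel, so the level of the
remaining word is first raised by one. -/
theorem exists_word_mem_level (hG : G.NoSinks) (w : List (Gen V E)) :
    ∃ n m : ℕ, (n : ℤ) - m = (w.map Gen.deg).sum ∧ (w.map (gen K G)).prod ∈ level K G n m := by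
  induction w with
  | nil =>
    refine ⟨0, 0, by simp, ?_⟩
    simp only [level, pow_zero, one_mul, mul_one, List.map_nil, List.prod_nil]
    rw [← sum_vert]
    exact sum_mem fun v _ => Submodule.subset_span ⟨v, rfl⟩
  | cons g w ih =>
    obtain ⟨n, m, hd, hw⟩ := ih
    simp only [List.map_cons, List.sum_cons, List.prod_cons, ← hd]
    cases g with
    | vertex v =>
      exact ⟨n, m, by simp [Gen.deg], vertSpan_mul_level K G n m
        (Submodule.mul_mem_mul (Submodule.subset_span ⟨v, rfl⟩) hw)⟩
    | edge e =>
      refine ⟨n + 1, m, by simp only [Gen.deg]; push_cast; ring, ?_⟩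
      rw [level_succ_left]
      exact Submodule.mul_mem_mul (Submodule.subset_span ⟨e, rfl⟩) hw
    | ghost e =>
      exact ⟨n, m + 1, by simp only [Gen.deg]; push_cast; ring, ghostSpan_mul_level K G n (m + 1)
        (Submodule.mul_mem_mul (Submodule.subset_span ⟨e, rfl⟩) (level_le_succ K hG n m hw))⟩

/-- In degree zero both path lengths agree, and the diagonal levels form an increasing chain, so
sums stay inside one level. -/
theorem exists_mem_level (hG : G.NoSinks) {a : LeavittPathAlgebra K G}
    (ha : a ∈ grading K G 0) : ∃ n, a ∈ level K G n n := by
  refine Submodule.span_induction (p := fun a _ => ∃ n, a ∈ level K G n n) ?_ ?_ ?_ ?_ ha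
  · rintro _ ⟨w, hw, rfl⟩
    obtain ⟨n, m, hd, h⟩ := exists_word_mem_level K hG w
    obtain rfl : n = m := by omega
    exact ⟨n, h⟩
  · exact ⟨0, zero_mem _⟩
  · rintro x y _ _ ⟨n, hx⟩ ⟨m, hy⟩
    exact ⟨max n m, add_mem (level_diag_mono K hG (le_max_left n m) hx)
      (level_diag_mono K hG (le_max_right n m) hy)⟩
  · rintro c x _ ⟨n, hx⟩
    exact ⟨n, Submodule.smul_mem _ c hx⟩

theorem exists_forall_mem_level (hG : G.NoSinks) {ι : Type*} [Finite ι]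
    (a : ι → LeavittPathAlgebra K G) (ha : ∀ i, a i ∈ grading K G 0) :
    ∃ n, ∀ i, a i ∈ level K G n n := by
  choose n hn using fun i => exists_mem_level K hG (ha i)
  obtain ⟨N, hN⟩ := Set.Finite.bddAbove (Set.finite_range n)
  exact ⟨N, fun i => level_diag_mono K hG (hN ⟨i, rfl⟩) (hn i)⟩

end Relations

/-! ### The vertices are nonzero -/

section Nonzero

/-- Without sinks, the set of edges leaving `v` is finite and nonempty, so its product with `ℕ` is
countably infinite, as is `{v} × ℕ`. Bijections chosen vertex by vertex are glued. -/
theorem exists_branching {V E : Type*} [Finite E] {G : DirGraph V E} (hG : G.NoSinks) :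
    ∃ T : V × ℕ ≃ E × ℕ, ∀ x, G.src (T x).1 = x.1 := by
  have h : ∀ v : V, Nonempty (ℕ ≃ {e // G.src e = v} × ℕ) := fun v => by
    obtain ⟨e, he⟩ := hG v
    have : Nonempty {e // G.src e = v} := ⟨⟨e, he⟩⟩
    exact nonempty_equiv_of_countable
  let T := fun v => (h v).some
  refine ⟨⟨fun x => ((T x.1 x.2).1.1, (T x.1 x.2).2),
    fun y => (G.src y.1, (T (G.src y.1)).symm (⟨y.1, rfl⟩, y.2)), ?_, ?_⟩,
    fun x => (T x.1 x.2).1.2⟩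
  · rintro ⟨v, n⟩
    -- The vertex `u` is kept independent of `v` so that the equation `G.src e = u` can be
    -- substituted.
    have key : ∀ (u : V) (p : {e // G.src e = u} × ℕ),
        ((G.src p.1.1, (T (G.src p.1.1)).symm (⟨p.1.1, rfl⟩, p.2)) : V × ℕ) =
          (u, (T u).symm p) := by
      rintro u ⟨⟨e, rfl⟩, k⟩
      rfl
    exact (key v (T v n)).trans (by rw [Equiv.symm_apply_apply])
  · rintro ⟨e, n⟩
    simp

variable (K : Type*) [Field K] {V E : Type*} [DecidableEq V] [Fintype V] [Fintype E]
  {G : DirGraph V E}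

open Classical in
/-- The action of the generators on functions on `V × ℕ` defined by a bijection of `V × ℕ` with
`E × ℕ`. -/
def branchingGen (T : V × ℕ ≃ E × ℕ) (G : DirGraph V E) : Gen V E → Module.End K (V × ℕ → K)
  | .vertex v =>
    { toFun := fun φ x => if x.1 = v then φ x else 0
      map_add' := fun φ ψ => by ext x; by_cases h : x.1 = v <;> simp [h]
      map_smul' := fun c φ => by ext x; simp }
  | .edge e =>
    { toFun := fun φ x => if (T x).1 = e then φ (G.tgt e, (T x).2) else 0
      map_add' := fun φ ψ => by ext x; by_cases h : (T x).1 = e <;> simp [h]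
      map_smul' := fun c φ => by ext x; simp }
  | .ghost e =>
    { toFun := fun φ x => if x.1 = G.tgt e then φ (T.symm (e, x.2)) else 0
      map_add' := fun φ ψ => by ext x; by_cases h : x.1 = G.tgt e <;> simp [h]
      map_smul' := fun c φ => by ext x; simp }

/-- The sets of points that `T` sends to `{e} × ℕ`, for `e` leaving `v`, partition `{v} × ℕ`, and
`T` identifies each of them with a copy of `{G.tgt e} × ℕ`. Edges and ghost edges act as transfers
along these identifications. -/
theorem branchingGen_rel (T : V × ℕ ≃ E × ℕ) (hT : ∀ x, G.src (T x).1 = x.1) {a b : Free K V E}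
    (h : Rel K G a b) : FreeAlgebra.lift K (branchingGen K T G) a =
      FreeAlgebra.lift K (branchingGen K T G) b := by
  have hT' : ∀ y, (T.symm y).1 = G.src y.1 := fun y => by rw [← hT, T.apply_symm_apply]
  cases h <;> simp only [map_mul, map_sum, map_one, map_zero, FreeAlgebra.lift_ι_apply] <;>
    refine LinearMap.ext fun φ => funext fun x => ?_
  case vertex_mul_self v =>
    simp only [branchingGen, Module.End.mul_apply, LinearMap.coe_mk, AddHom.coe_mk]
    split_ifs <;> rfl
  case vertex_mul_ne v w h =>
    simp only [branchingGen, Module.End.mul_apply, LinearMap.coe_mk, AddHom.coe_mk]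
    split_ifs with h1 h2
    · exact absurd (h1.symm.trans h2) h
    · rfl
    · rfl
  case src_mul_edge e =>
    simp only [branchingGen, Module.End.mul_apply, LinearMap.coe_mk, AddHom.coe_mk]
    split_ifs with h1 h2 h2
    · rfl
    · rfl
    · exact absurd (by rw [← h2, hT]) h1
    · rfl
  case edge_mul_tgt e =>
    simp [branchingGen]
  case tgt_mul_ghost e =>
    simp only [branchingGen, Module.End.mul_apply, LinearMap.coe_mk, AddHom.coe_mk]
    split_ifs <;> rfl
  case ghost_mul_src e =>
    simp [branchingGen, hT']
  case ghost_mul_edge_self e =>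
    simp only [branchingGen, Module.End.mul_apply, LinearMap.coe_mk, AddHom.coe_mk,
      Equiv.apply_symm_apply, if_true]
    split_ifs with h1
    · rw [← h1]
    · rfl
  case ghost_mul_edge_ne e f h =>
    simp [branchingGen, h]
  case sum_edge_mul_ghost v h =>
    classical
    simp only [branchingGen, Module.End.mul_apply, LinearMap.coe_mk, AddHom.coe_mk,
      LinearMap.sum_apply, Finset.sum_apply, if_true]
    rw [Finset.sum_ite_eq (Finset.univ.filter fun e => G.src e = v) (T x).1
      (fun e => φ (T.symm (e, (T x).2)))]
    simp [hT]
  case one =>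
    simp [branchingGen, LinearMap.sum_apply, Finset.sum_apply]

/-- The relations alone do not show that the quotient is nontrivial; a representation does. This
makes vertex bases linearly independent over `K`, so that their members can be counted by
dimensions. -/
theorem vert_ne_zero (hG : G.NoSinks) (v : V) : vert K G v ≠ 0 := by
  obtain ⟨T, hT⟩ := exists_branching hG
  let f : LeavittPathAlgebra K G →ₐ[K] Module.End K (V × ℕ → K) :=
    RingQuot.liftAlgHom K ⟨FreeAlgebra.lift K (branchingGen K T G),
      fun _ _ h => branchingGen_rel K T hT h⟩
  have hf : f (vert K G v) = branchingGen K T G (.vertex v) :=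
    (RingQuot.liftAlgHom_mkAlgHom_apply K (FreeAlgebra.lift K (branchingGen K T G))
      (fun _ _ h => branchingGen_rel K T hT h) (FreeAlgebra.ι K (Gen.vertex v))).trans (by simp)
  intro h
  rw [h, map_zero] at hf
  -- The vertex sends the constant function `1` to the indicator of `{v} × ℕ`.
  have := congrFun (LinearMap.congr_fun hf fun _ => 1) (v, 0)
  simp [branchingGen] at this

end Nonzero

end LeavittPathAlgebra

end

noncomputable section

/-! ### Graded modules over a general graded algebra. -/

namespace GrProj

open MulOpposite

universe u v

variable {K : Type v} {A : Type u} [Field K] [Ring A] [Algebra K A] {𝒜 : ℤ → Submodule K A}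

/-! ### Homogeneous components -/

/-- A graded module is the direct sum of its components. -/
def decomp (M : GrProj 𝒜) : (⨁ i, M.comp i) ≃+ M.carrier :=
  AddEquiv.ofBijective (DirectSum.coeAddMonoidHom M.comp) M.internal

theorem decomp_of (M : GrProj 𝒜) {d : ℤ} (x : M.comp d) :
    M.decomp (DirectSum.of (fun i => M.comp i) d x) = x :=
  DirectSum.coeAddMonoidHom_of M.comp d x

theorem decomp_symm (M : GrProj 𝒜) {d : ℤ} {x : M.carrier} (hx : x ∈ M.comp d) :
    M.decomp.symm x = DirectSum.of (fun i => M.comp i) d ⟨x, hx⟩ := by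
  rw [AddEquiv.symm_apply_eq, decomp_of]

theorem induction_homogeneous (M : GrProj 𝒜) {p : M.carrier → Prop} (h0 : p 0)
    (hom : ∀ d x, x ∈ M.comp d → p x) (add : ∀ x y, p x → p y → p (x + y)) (x : M.carrier) :
    p x := by
  obtain ⟨y, rfl⟩ := M.decomp.surjective x
  induction y using DirectSum.induction_on with
  | zero => rwa [map_zero]
  | of d y =>
    rw [decomp_of]
    exact hom d _ y.2
  | add y z hy hz =>
    rw [map_add]
    exact add _ _ hy hz

/-- The homogeneous component of degree `d` of an element of a graded module. -/
def proj (M : GrProj 𝒜) (d : ℤ) : M.carrier →+ M.carrier where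
  toFun x := (M.decomp.symm x d : M.carrier)
  map_zero' := by simp
  map_add' x y := by simp

theorem proj_of_mem (M : GrProj 𝒜) {d : ℤ} {x : M.carrier} (hx : x ∈ M.comp d) :
    M.proj d x = x := by
  change (M.decomp.symm x d : M.carrier) = x
  rw [M.decomp_symm hx, DirectSum.of_eq_same]

theorem proj_of_mem_ne (M : GrProj 𝒜) {d d' : ℤ} (h : d ≠ d') {x : M.carrier}
    (hx : x ∈ M.comp d) : M.proj d' x = 0 := by
  change (M.decomp.symm x d' : M.carrier) = 0
  rw [M.decomp_symm hx, DirectSum.of_eq_of_ne _ _ _ h.symm]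
  rfl

theorem proj_smul [GradedAlgebra 𝒜] (M : GrProj 𝒜) {N : ℤ} {m : M.carrier} (hm : m ∈ M.comp N)
    (a : A) (d : ℤ) :
    M.proj (N + d) (op a • m) = op (DirectSum.decompose 𝒜 a d : A) • m := by
  induction a using DirectSum.Decomposition.inductionOn 𝒜 with
  | zero => simp
  | @homogeneous k a =>
    by_cases h : k = d
    · subst h
      rw [DirectSum.decompose_of_mem_same _ a.2]
      exact M.proj_of_mem (M.smul_mem _ _ _ _ hm a.2)
    · rw [DirectSum.decompose_of_mem_ne _ a.2 h, op_zero, zero_smul]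
      exact M.proj_of_mem_ne (by omega) (M.smul_mem _ _ _ _ hm a.2)
  | add a b ha hb =>
    rw [op_add, add_smul, map_add, ha, hb, DirectSum.decompose_add, DirectSum.add_apply,
      Submodule.coe_add, op_add, add_smul]

/-- Project to degree `n`: on `q i a`, with `q i` of degree `N`, only the part of `a` of degree `n -
N` survives. -/
theorem sum_smul_eq_of_mem [GradedAlgebra 𝒜] (M : GrProj 𝒜) {ι : Type*} [Fintype ι] {N n : ℤ}
    {q : ι → M.carrier} (hq : ∀ i, q i ∈ M.comp N) {a : ι → A}
    (hx : ∑ i, op (a i) • q i ∈ M.comp n) :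
    ∑ i, op (a i) • q i = ∑ i, op (DirectSum.decompose 𝒜 (a i) (n - N) : A) • q i := by
  have h := M.proj_of_mem hx
  rw [← h, map_sum]
  refine Finset.sum_congr rfl fun i _ => ?_
  rw [← M.proj_smul (hq i), add_sub_cancel]

/-- The part of degree `-N` of a linear form on a graded module. -/
theorem exists_graded_part [GradedAlgebra 𝒜] (M : GrProj 𝒜) (s : M.carrier →ₗ[Aᵐᵒᵖ] A) (N : ℤ) :
    ∃ t : M.carrier →ₗ[Aᵐᵒᵖ] A, ∀ d x, x ∈ M.comp d →
      t x = (DirectSum.decompose 𝒜 (s x) (d - N) : A) := by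
  let φ : ∀ d, M.comp d →+ A := fun d =>
    { toFun := fun x => (DirectSum.decompose 𝒜 (s x) (d - N) : A)
      map_zero' := by simp
      map_add' := fun x y => by simp }
  let t₀ : M.carrier →+ A := (DirectSum.toAddMonoid φ).comp M.decomp.symm.toAddMonoidHom
  have ht : ∀ d x, x ∈ M.comp d → t₀ x = (DirectSum.decompose 𝒜 (s x) (d - N) : A) := by
    intro d x hx
    change DirectSum.toAddMonoid φ (M.decomp.symm x) = _
    rw [M.decomp_symm hx, DirectSum.toAddMonoid_of]
    rfl
  refine ⟨{ t₀ with map_smul' := ?_ }, ht⟩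
  intro a x
  change t₀ (a • x) = t₀ x * unop a
  obtain ⟨a, rfl⟩ := op_surjective a
  rw [unop_op]
  induction x using M.induction_homogeneous with
  | h0 => simp
  | add x y hx hy => rw [smul_add, map_add, hx, hy, map_add, add_mul]
  | hom d x hx =>
    induction a using DirectSum.Decomposition.inductionOn 𝒜 with
    | zero => simp
    | @homogeneous k a =>
      rw [ht _ _ (M.smul_mem _ _ _ _ hx a.2), ht _ _ hx, map_smul]
      change ((DirectSum.decompose 𝒜 (s x * (a : A)) (d + k - N) : 𝒜 _) : A) = _
      rw [add_sub_right_comm, DirectSum.coe_decompose_mul_add_of_right_mem 𝒜 a.2]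
    | add a b ha hb => rw [op_add, add_smul, map_add, ha, hb, mul_add]

/-! ### The module generated by a homogeneous idempotent -/

/-- The right ideal generated by an idempotent `e`. -/
def cornerIdeal (e : A) : Submodule Aᵐᵒᵖ A where
  carrier := {a | e * a = a}
  add_mem' {a b} ha hb := by
    change e * (a + b) = a + b
    rw [mul_add, ha, hb]
  zero_mem' := mul_zero e
  smul_mem' c a ha := by
    change e * (a * unop c) = a * unop c
    rw [← mul_assoc, ha]

theorem mem_cornerIdeal {e a : A} : a ∈ cornerIdeal e ↔ e * a = a := Iff.rfl

/-- The retraction of `A` on the right ideal generated by an idempotent. -/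
def cornerRetraction (e : A) (he : e * e = e) : A →ₗ[Aᵐᵒᵖ] cornerIdeal e where
  toFun a := ⟨e * a, by rw [mem_cornerIdeal, ← mul_assoc, he]⟩
  map_add' a b := Subtype.ext (mul_add e a b)
  map_smul' c a := Subtype.ext (mul_assoc e a (unop c)).symm

theorem cornerRetraction_comp (e : A) (he : e * e = e) :
    (cornerRetraction e he).comp (cornerIdeal e).subtype = LinearMap.id :=
  LinearMap.ext fun a => Subtype.ext a.2

/-- As `e` has degree zero, left multiplication by `e` commutes with taking components, so the
components of an element of `e A` stay in `e A`. -/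
theorem isInternal_cornerIdeal [GradedAlgebra 𝒜] {e : A} (he₀ : e ∈ 𝒜 0) :
    DirectSum.IsInternal fun i =>
      (𝒜 i).toAddSubgroup.comap (cornerIdeal e).subtype.toAddMonoidHom := by
  set 𝒞 := fun i => (𝒜 i).toAddSubgroup.comap (cornerIdeal e).subtype.toAddMonoidHom
  have hd : ∀ (a : cornerIdeal e) d, (DirectSum.decompose 𝒜 (a : A) d : A) ∈ cornerIdeal e := by
    intro a d
    have h := DirectSum.coe_decompose_mul_add_of_left_mem 𝒜 (j := d) (b := (a : A)) he₀
    rw [mem_cornerIdeal.1 a.2, zero_add] at h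
    exact h.symm
  let j : ∀ i, 𝒞 i →+ 𝒜 i := fun i =>
    { toFun := fun x => ⟨x.1.1, x.2⟩, map_zero' := rfl, map_add' := fun _ _ => rfl }
  have hj : (DirectSum.coeAddMonoidHom 𝒜).comp (DirectSum.map j) =
      (cornerIdeal e).subtype.toAddMonoidHom.comp (DirectSum.coeAddMonoidHom 𝒞) := by
    ext i x
    simp [j]
  constructor
  · refine (injective_iff_map_eq_zero _).2 fun x hx => ?_
    have h : DirectSum.map j x = 0 := by
      refine (injective_iff_map_eq_zero _).1 (DirectSum.Decomposition.isInternal 𝒜).1 _ ?_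
      exact (DFunLike.congr_fun hj x).trans (congrArg Subtype.val hx)
    refine DFinsupp.ext fun i => Subtype.ext (Subtype.ext ?_)
    have := congrArg Subtype.val (DFunLike.congr_fun h i)
    rwa [DirectSum.map_apply] at this
  · intro a
    classical
    refine ⟨∑ d ∈ (DirectSum.decompose 𝒜 (a : A)).support, DirectSum.of (fun i => 𝒞 i) d
      ⟨⟨DirectSum.decompose 𝒜 (a : A) d, hd a d⟩, (DirectSum.decompose 𝒜 (a : A) d).2⟩, ?_⟩
    rw [map_sum]
    simp only [DirectSum.coeAddMonoidHom_of]
    refine Subtype.ext ?_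
    rw [AddSubmonoidClass.coe_finsetSum]
    exact DirectSum.sum_support_decompose 𝒜 (a : A)

/-- The graded right module `e A` of a homogeneous idempotent `e`. -/
def corner [GradedAlgebra 𝒜] (e : A) (he : e * e = e) (he₀ : e ∈ 𝒜 0) : GrProj 𝒜 where
  carrier := cornerIdeal e
  comp i := (𝒜 i).toAddSubgroup.comap (cornerIdeal e).subtype.toAddMonoidHom
  internal := isInternal_cornerIdeal he₀
  smul_mem i j m a hm ha := by
    have hm' : (m : A) ∈ 𝒜 i := hm
    exact SetLike.GradedMul.mul_mem hm' ha
  finite := by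
    have := Module.Finite.equiv (regularEquiv A)
    exact Module.Finite.of_surjective (cornerRetraction e he)
      (Function.LeftInverse.surjective (g := Subtype.val)
        fun a => LinearMap.congr_fun (cornerRetraction_comp e he) a)
  projective := by
    have := Module.Projective.of_equiv (regularEquiv A)
    exact Module.Projective.of_split _ _ (cornerRetraction_comp e he)

end GrProj

end

noncomputable section

namespace LeavittPathAlgebra

open MulOpposite GrProj

variable {K V E : Type*} [Field K] [DecidableEq V]

/-! ### Multiplicities of vertices in a family. -/

section Count

/-- The number of indices of each vertex. -/
def vertexCount {ι : Type*} [Fintype ι] (v : ι → V) : V → ℕ := ∑ i, Pi.single (v i) 1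

theorem vertexCount_apply {ι : Type*} [Fintype ι] (v : ι → V) (u : V) :
    vertexCount v u = Fintype.card {i // v i = u} := by
  simp only [vertexCount, Finset.sum_apply, Pi.single_apply, Fintype.card_subtype,
    Finset.sum_boole, Nat.cast_id]
  exact congrArg Finset.card (Finset.filter_congr fun i _ => eq_comm)

theorem vertexCount_comp_equiv {ι κ : Type*} [Fintype ι] [Fintype κ] (e : κ ≃ ι) (v : ι → V) :
    vertexCount (v ∘ e) = vertexCount v :=
  e.sum_comp fun i => Pi.single (v i) 1

theorem vertexCount_sumElim {ι κ : Type*} [Fintype ι] [Fintype κ] (v : ι → V) (w : κ → V) :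
    vertexCount (Sum.elim v w) = vertexCount v + vertexCount w := by
  simp [vertexCount]

theorem row_adjMatrix [Fintype E] (G : DirGraph V E) (u : V) :
    G.adjMatrix u = ∑ e : {e // G.src e = u}, Pi.single (G.tgt e) 1 := by
  ext w
  simp only [DirGraph.adjMatrix, Matrix.of_apply, Finset.sum_apply, Pi.single_apply,
    Finset.sum_boole, Nat.cast_id]
  rw [← Fintype.card_subtype]
  refine Fintype.card_congr ?_
  exact (Equiv.subtypeSubtypeEquivSubtypeInter _ _).symm.trans
    (Equiv.subtypeEquivRight fun e => eq_comm)

end Count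

variable [Fintype V] [Fintype E] {G : DirGraph V E}

/-! ### Vertex bases -/

/-- A family of homogeneous elements `q i` of degree `N` of a graded right module over a Leavitt
path algebra which generates the module and satisfies `q i = q i * v i`. -/
structure IsVertexFamily (M : GrProj (grading K G)) (N : ℤ) {ι : Type*} (v : ι → V)
    (q : ι → M.carrier) : Prop where
  mem : ∀ i, q i ∈ M.comp N
  mul_vert : ∀ i, op (vert K G (v i)) • q i = q i
  span : Submodule.span (LeavittPathAlgebra K G)ᵐᵒᵖ (Set.range q) = ⊤

/-- A family of homogeneous elements `q i` of degree `N` which exhibits a graded right module as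
the direct sum of the modules generated by the vertices `v i`. -/
structure IsVertexBasis (M : GrProj (grading K G)) (N : ℤ) {ι : Type*} [Fintype ι] (v : ι → V)
    (q : ι → M.carrier) : Prop extends IsVertexFamily M N v q where
  indep : ∀ a : ι → LeavittPathAlgebra K G, ∑ i, op (a i) • q i = 0 →
    ∀ i, vert K G (v i) * a i = 0

/-- The vertices of the family obtained by multiplying each member of a family by the edges. -/
abbrev pushVert (G : DirGraph V E) {ι : Type*} (v : ι → V) (p : Σ i, {e // G.src e = v i}) : V :=
  G.tgt p.2.1

/-- The family obtained by multiplying each member of a family by the edges. -/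
abbrev pushFamily (M : GrProj (grading K G)) {ι : Type*} (v : ι → V) (q : ι → M.carrier)
    (p : Σ i, {e // G.src e = v i}) : M.carrier := op (edge K G p.2.1) • q p.1

theorem vertexCount_push {ι : Type*} [Fintype ι] (v : ι → V) :
    vertexCount (pushVert G v) = Matrix.vecMul (vertexCount v) G.adjMatrix := by
  rw [vertexCount, vertexCount, Fintype.sum_sigma, Matrix.sum_vecMul]
  refine Finset.sum_congr rfl fun i _ => ?_
  rw [Matrix.single_one_vecMul]
  exact (row_adjMatrix G (v i)).symm

theorem sum_edge_mul_ghost_subtype (hG : G.NoSinks) (v : V) :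
    ∑ e : {e // G.src e = v}, edge K G e * ghost K G e = vert K G v := by
  rw [← sum_edge_mul_ghost K G (hG v)]
  exact (Finset.sum_subtype _ (by simp) fun e => edge K G e * ghost K G e).symm

/-- Expand `q i a = q i (∑ e e*) a`: the coefficient of `q i e` is `e* a`. -/
theorem sum_push (hG : G.NoSinks) {M : GrProj (grading K G)} {ι : Type*} [Fintype ι]
    {v : ι → V} {q : ι → M.carrier} (hq : ∀ i, op (vert K G (v i)) • q i = q i)
    (a : ι → LeavittPathAlgebra K G) :
    ∑ p : Σ i, {e // G.src e = v i}, op (ghost K G p.2.1 * a p.1) • pushFamily M v q p =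
      ∑ i, op (a i) • q i := by
  rw [Fintype.sum_sigma]
  refine Finset.sum_congr rfl fun i _ => ?_
  simp only [pushFamily, smul_smul, ← op_mul, ← mul_assoc]
  rw [← Finset.sum_smul, ← Finset.op_sum, ← Finset.sum_mul, sum_edge_mul_ghost_subtype hG,
    op_mul, mul_smul, hq]

theorem sum_push' {M : GrProj (grading K G)} {ι : Type*} [Fintype ι]
    {v : ι → V} {q : ι → M.carrier}
    (a : (Σ i, {e // G.src e = v i}) → LeavittPathAlgebra K G) :
    ∑ p, op (a p) • pushFamily M v q p =
      ∑ i, op (∑ e : {e // G.src e = v i}, edge K G e * a ⟨i, e⟩) • q i := by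
  rw [Fintype.sum_sigma]
  refine Finset.sum_congr rfl fun i _ => ?_
  simp only [pushFamily, smul_smul, ← op_mul]
  rw [← Finset.sum_smul, ← Finset.op_sum]

namespace IsVertexFamily

variable {M : GrProj (grading K G)} {N : ℤ} {ι κ : Type*} {v : ι → V} {q : ι → M.carrier}

theorem exists_coeff [Fintype ι] (h : IsVertexFamily M N v q) (x : M.carrier) :
    ∃ a : ι → LeavittPathAlgebra K G, x = ∑ i, op (a i) • q i := by
  obtain ⟨c, hc⟩ := (Submodule.mem_span_range_iff_exists_fun _).1
    (h.span ▸ Submodule.mem_top (x := x))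
  exact ⟨fun i => unop (c i), hc.symm⟩

theorem of_exists_coeff [Fintype ι] (mem : ∀ i, q i ∈ M.comp N)
    (mul_vert : ∀ i, op (vert K G (v i)) • q i = q i)
    (h : ∀ x, ∃ a : ι → LeavittPathAlgebra K G, x = ∑ i, op (a i) • q i) :
    IsVertexFamily M N v q := by
  refine ⟨mem, mul_vert, eq_top_iff.2 fun x _ => ?_⟩
  obtain ⟨a, ha⟩ := h x
  exact (Submodule.mem_span_range_iff_exists_fun _).2 ⟨fun i => op (a i), ha.symm⟩

theorem reindex (h : IsVertexFamily M N v q) (e : κ ≃ ι) :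
    IsVertexFamily M N (v ∘ e) (q ∘ e) :=
  ⟨fun i => h.mem _, fun i => h.mul_vert _, by rw [e.surjective.range_comp, h.span]⟩

theorem push [Fintype ι] (hG : G.NoSinks) (h : IsVertexFamily M N v q) :
    IsVertexFamily M (N + 1) (pushVert G v) (pushFamily M v q) := by
  refine of_exists_coeff (fun p => M.smul_mem _ _ _ _ (h.mem _) (edge_mem K G _)) (fun p => ?_)
    fun x => ?_
  · rw [pushFamily, smul_smul, ← op_mul, edge_mul_tgt]
  · obtain ⟨a, rfl⟩ := h.exists_coeff x
    exact ⟨fun p => ghost K G p.2.1 * a p.1, (sum_push hG h.mul_vert a).symm⟩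

end IsVertexFamily

namespace IsVertexBasis

variable {M M' : GrProj (grading K G)} {N : ℤ} {ι κ : Type*} [Fintype ι] [Fintype κ] {v : ι → V}
  {q : ι → M.carrier}

theorem reindex (h : IsVertexBasis M N v q) (e : κ ≃ ι) :
    IsVertexBasis M N (v ∘ e) (q ∘ e) := by
  refine ⟨h.toIsVertexFamily.reindex e, fun a ha i => ?_⟩
  have := h.indep (a ∘ e.symm) ?_ (e i)
  · simpa using this
  · rw [← ha, ← e.sum_comp]
    simp

/-- This is the decomposition of `v L` as the direct sum of the `e L` over edges `e` leaving `v`.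
Independence comes from multiplying on the left by `f*`, which isolates the coefficient of `f`. -/
theorem push (hG : G.NoSinks) (h : IsVertexBasis M N v q) :
    IsVertexBasis M (N + 1) (pushVert G v) (pushFamily M v q) := by
  refine ⟨h.toIsVertexFamily.push hG, ?_⟩
  rintro a ha ⟨i, f⟩
  rw [sum_push'] at ha
  have h₁ := h.indep _ ha i
  rw [Finset.mul_sum] at h₁
  have h₂ : ∑ e : {e // G.src e = v i}, edge K G e * a ⟨i, e⟩ = 0 := by
    rw [← h₁]
    refine Finset.sum_congr rfl fun e _ => ?_
    have he := src_mul_edge K G e.1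
    rw [e.2] at he
    rw [← mul_assoc, he]
  have h₃ := congrArg (ghost K G f.1 * ·) h₂
  simp only [mul_zero, Finset.mul_sum, ← mul_assoc] at h₃
  rw [Finset.sum_eq_single f, ghost_mul_edge_self] at h₃
  · exact h₃
  · intro e _ hef
    rw [ghost_mul_edge_ne K G fun h => hef (Subtype.ext h.symm), zero_mul]
  · simp

/-- Coefficients in a vertex basis are determined only up to left multiplication by `v i`. This
suffices, since any target with `q' i = q' i v i` sees only `v i a i`; it makes `lift` well defined.
-/
theorem coeff_unique (h : IsVertexBasis M N v q) {q' : ι → M'.carrier}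
    (hq' : ∀ i, op (vert K G (v i)) • q' i = q' i) {a b : ι → LeavittPathAlgebra K G}
    (hab : ∑ i, op (a i) • q i = ∑ i, op (b i) • q i) :
    ∑ i, op (a i) • q' i = ∑ i, op (b i) • q' i := by
  rw [← sub_eq_zero, ← Finset.sum_sub_distrib] at hab ⊢
  simp only [← sub_smul, ← op_sub] at hab ⊢
  refine Finset.sum_eq_zero fun i _ => ?_
  rw [← hq', smul_smul, ← op_mul, h.indep _ hab i, op_zero, zero_smul]

/-- The linear map which sends a vertex basis to a family. -/
def lift (h : IsVertexBasis M N v q) {q' : ι → M'.carrier}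
    (hq' : ∀ i, op (vert K G (v i)) • q' i = q' i) :
    M.carrier →ₗ[(LeavittPathAlgebra K G)ᵐᵒᵖ] M'.carrier where
  toFun x := ∑ i, op ((h.exists_coeff x).choose i) • q' i
  map_add' x y := by
    simp only [← Finset.sum_add_distrib, ← add_smul, ← op_add]
    refine h.coeff_unique hq' ?_
    rw [← (h.exists_coeff (x + y)).choose_spec]
    simp only [op_add, add_smul, Finset.sum_add_distrib]
    rw [← (h.exists_coeff x).choose_spec, ← (h.exists_coeff y).choose_spec]
  map_smul' c x := by
    obtain ⟨c, rfl⟩ := op_surjective c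
    simp only [RingHom.id_apply, Finset.smul_sum, smul_smul, ← op_mul]
    refine h.coeff_unique hq' ?_
    rw [← (h.exists_coeff (op c • x)).choose_spec]
    simp only [op_mul, mul_smul, ← Finset.smul_sum]
    rw [← (h.exists_coeff x).choose_spec]

theorem lift_sum (h : IsVertexBasis M N v q) {q' : ι → M'.carrier}
    (hq' : ∀ i, op (vert K G (v i)) • q' i = q' i) (a : ι → LeavittPathAlgebra K G) :
    h.lift hq' (∑ i, op (a i) • q i) = ∑ i, op (a i) • q' i :=
  h.coeff_unique hq' (h.exists_coeff _).choose_spec.symm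

theorem lift_mem (h : IsVertexBasis M N v q) {q' : ι → M'.carrier}
    (hq' : ∀ i, op (vert K G (v i)) • q' i = q' i) (hm : ∀ i, q' i ∈ M'.comp N) {n : ℤ}
    {x : M.carrier} (hx : x ∈ M.comp n) : h.lift hq' x ∈ M'.comp n := by
  obtain ⟨a, rfl⟩ := h.exists_coeff x
  rw [M.sum_smul_eq_of_mem h.mem hx, h.lift_sum hq']
  refine sum_mem fun i _ => ?_
  have := M'.smul_mem N (n - N) (q' i) _ (hm i)
    (DirectSum.decompose (grading K G) (a i) (n - N)).2
  rwa [add_sub_cancel] at this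

theorem lift_lift (h : IsVertexBasis M N v q) {q' : ι → M'.carrier}
    (h' : IsVertexBasis M' N v q') (x : M.carrier) :
    h'.lift h.mul_vert (h.lift h'.mul_vert x) = x := by
  obtain ⟨a, rfl⟩ := h.exists_coeff x
  rw [h.lift_sum, h'.lift_sum]

/-- The degree and the vertices of a basis determine the graded module: the two lifts are mutually
inverse and preserve degrees. -/
theorem mk_eq (h : IsVertexBasis M N v q) {q' : ι → M'.carrier}
    (h' : IsVertexBasis M' N v q') : VGr.mk M = VGr.mk M' :=
  VGr.mk_eq (LinearEquiv.ofLinearMap (h.lift h'.mul_vert) (h'.lift h.mul_vert)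
    (LinearMap.ext (h'.lift_lift h)) (LinearMap.ext (h.lift_lift h'))) fun i m =>
      ⟨h.lift_mem h'.mul_vert h'.mem, fun hm => by
        rw [← h.lift_lift h' m]
        exact h'.lift_mem h.mul_vert h.mem hm⟩

theorem of_iso (h : IsVertexBasis M N v q)
    (f : M.carrier ≃ₗ[(LeavittPathAlgebra K G)ᵐᵒᵖ] M'.carrier)
    (hf : ∀ i m, m ∈ M.comp i ↔ f m ∈ M'.comp i) : IsVertexBasis M' N v (f ∘ q) := by
  refine ⟨⟨fun i => (hf _ _).1 (h.mem i), fun i => ?_, ?_⟩, fun a ha => h.indep a ?_⟩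
  · rw [Function.comp_apply, ← map_smul, h.mul_vert]
  · have : Set.range (f ∘ q) = f.toLinearMap '' Set.range q := by
      rw [Set.range_comp]
      rfl
    rw [this, ← Submodule.map_span, h.span, Submodule.map_top, LinearEquiv.range]
  · refine f.injective ?_
    rw [map_sum, map_zero, ← ha]
    simp

theorem add (h : IsVertexBasis M N v q) {w : κ → V} {q' : κ → M'.carrier}
    (h' : IsVertexBasis M' N w q') :
    IsVertexBasis (M.add M') N (Sum.elim v w)
      (Sum.elim (fun i => ((q i, 0) : M.carrier × M'.carrier)) fun j => (0, q' j)) := by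
  have key : ∀ a : ι ⊕ κ → LeavittPathAlgebra K G,
      ∑ i, op (a i) • (Sum.elim (fun i => ((q i, 0) : M.carrier × M'.carrier))
        fun j => (0, q' j)) i =
        (∑ i, op (a (.inl i)) • q i, ∑ j, op (a (.inr j)) • q' j) := by
    intro a
    rw [Fintype.sum_sum_type]
    refine Prod.ext ?_ ?_
    · simp [Prod.fst_sum]
    · simp [Prod.snd_sum]
  refine ⟨.of_exists_coeff ?_ ?_ ?_, ?_⟩
  · rintro (i | j)
    · exact ⟨h.mem i, zero_mem _⟩
    · exact ⟨zero_mem _, h'.mem j⟩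
  · rintro (i | j)
    · exact Prod.ext (h.mul_vert i) (smul_zero _)
    · exact Prod.ext (smul_zero _) (h'.mul_vert j)
  · rintro ⟨x, y⟩
    obtain ⟨a, ha⟩ := h.exists_coeff x
    obtain ⟨b, hb⟩ := h'.exists_coeff y
    exact ⟨Sum.elim a b, (Prod.ext ha hb).trans (key (Sum.elim a b)).symm⟩
  · intro a ha
    have := (key a).symm.trans ha
    rintro (i | j)
    · exact h.indep (fun i => a (.inl i)) (congrArg Prod.fst this) i
    · exact h'.indep (fun i => a (.inr i)) (congrArg Prod.snd this) j

end IsVertexBasis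

/-! ### The modules generated by the vertices -/

/-- The graded right module generated by a vertex. -/
def vertexModule (K : Type*) [Field K] (G : DirGraph V E) (v : V) : GrProj (grading K G) :=
  GrProj.corner (vert K G v) (vert_mul_self K G v) (vert_mem K G v)

/-- The shift by `-N` moves the degree zero generator `v` of `v L` to degree `N`. -/
theorem isVertexBasis_vertexModule (N : ℤ) (v : V) :
    IsVertexBasis ((vertexModule K G v).shift (-N)) N (fun _ : Unit => v)
      (fun _ => (⟨vert K G v, vert_mul_self K G v⟩ : cornerIdeal (vert K G v))) := by
  have hs : ∀ a : LeavittPathAlgebra K G, ((op a •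
      (⟨vert K G v, vert_mul_self K G v⟩ : cornerIdeal (vert K G v)) :
        cornerIdeal (vert K G v)) : LeavittPathAlgebra K G) = vert K G v * a := fun a => rfl
  refine ⟨.of_exists_coeff (fun _ => ?_) (fun _ => ?_) fun x => ?_, fun a ha _ => ?_⟩
  · change vert K G v ∈ grading K G (N + -N)
    rw [add_neg_cancel]
    exact vert_mem K G v
  · exact Subtype.ext ((hs _).trans (vert_mul_self K G v))
  · refine ⟨fun _ => (show cornerIdeal (vert K G v) from x).1, Subtype.ext ?_⟩
    rw [Fintype.sum_unique]
    exact (show cornerIdeal (vert K G v) from x).2.symm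
  · rw [Fintype.sum_unique] at ha
    exact congrArg Subtype.val ha

theorem exists_isVertexBasis_fin (N : ℤ) {n : ℕ} (v : Fin n → V) :
    ∃ (M : GrProj (grading K G)) (q : Fin n → M.carrier), IsVertexBasis M N v q ∧
      VGr.mk M = ∑ i, VGr.shift (-N) (VGr.mk (vertexModule K G (v i))) := by
  induction n with
  | zero =>
    refine ⟨GrProj.zero, fun _ => 0, ⟨⟨fun i => i.elim0, fun i => i.elim0, ?_⟩,
      fun _ _ i => i.elim0⟩, rfl⟩
    exact eq_top_iff.2 fun x _ => by
      have : x = 0 := Subsingleton.elim (α := PUnit) x 0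
      rw [this]
      exact zero_mem _
  | succ n ih =>
    obtain ⟨M, q, hq, hM⟩ := ih fun i => v i.succ
    let ε : Fin (n + 1) ≃ Unit ⊕ Fin n :=
      (finSuccEquiv n).trans ((Equiv.optionEquivSumPUnit _).trans (Equiv.sumComm _ _))
    have h := ((isVertexBasis_vertexModule (K := K) (G := G) N (v 0)).add hq).reindex ε
    have hv : Sum.elim (fun _ : Unit => v 0) (fun i => v i.succ) ∘ ε = v :=
      funext (Fin.cases (by simp [ε]) fun i => by simp [ε])
    rw [hv] at h
    refine ⟨_, _, h, ?_⟩
    rw [Fin.sum_univ_succ, ← hM]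
    rfl

theorem exists_isVertexBasis {ι : Type*} [Fintype ι] (N : ℤ) (v : ι → V) :
    ∃ (M : GrProj (grading K G)) (q : ι → M.carrier), IsVertexBasis M N v q ∧
      VGr.mk M = ∑ i, VGr.shift (-N) (VGr.mk (vertexModule K G (v i))) := by
  obtain ⟨M, q, hq, hM⟩ :=
    exists_isVertexBasis_fin (K := K) (G := G) N (v ∘ (Fintype.equivFin ι).symm)
  have h := hq.reindex (Fintype.equivFin ι)
  rw [Function.comp_assoc, Equiv.symm_comp_self, Function.comp_id] at h
  refine ⟨M, _, h, hM.trans ?_⟩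
  exact (Fintype.equivFin ι).symm.sum_comp fun i =>
    VGr.shift (-N) (VGr.mk (vertexModule K G (v i)))

theorem IsVertexBasis.mk_eq_sum {M : GrProj (grading K G)} {N : ℤ} {ι : Type*} [Fintype ι]
    {v : ι → V} {q : ι → M.carrier} (h : IsVertexBasis M N v q) :
    VGr.mk M = ∑ i, VGr.shift (-N) (VGr.mk (vertexModule K G (v i))) := by
  obtain ⟨M', q', h', hM'⟩ := exists_isVertexBasis (K := K) (G := G) N v
  rw [← hM', h.mk_eq h']

end LeavittPathAlgebra

end

noncomputable section

/-! ### The vector space underlying a graded module. -/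

namespace GrProj

open MulOpposite

variable {K A : Type*} [Field K] [Ring A] [Algebra K A] {𝒜 : ℤ → Submodule K A}

/-- The vector space underlying a graded module over a graded algebra. -/
@[reducible]
def vectorSpace (M : GrProj 𝒜) : Module K M.carrier :=
  Module.compHom M.carrier (algebraMap K Aᵐᵒᵖ)

theorem isScalarTower_vectorSpace (M : GrProj 𝒜) :
    letI := M.vectorSpace
    IsScalarTower K Aᵐᵒᵖ M.carrier := by
  let := M.vectorSpace
  refine ⟨fun c a m => ?_⟩
  rw [Algebra.smul_def, mul_smul]
  rfl

end GrProj

namespace LeavittPathAlgebra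

open MulOpposite GrProj

universe t

variable {K V : Type*} {E : Type t} [Field K] [DecidableEq V] [Fintype V] [Fintype E]
  {G : DirGraph V E}

attribute [local instance] GrProj.vectorSpace GrProj.isScalarTower_vectorSpace

/-- The vertices are orthogonal idempotents, so a compression of their span by two of them retains
at most one coefficient. At level zero, coefficients thereby become scalars. -/
theorem exists_vert_mul_mul_vert {b : LeavittPathAlgebra K G} (hb : b ∈ level K G 0 0) (v w : V) :
    ∃ c : K, vert K G v * b * vert K G w = c • vert K G v ∧ (v ≠ w → c = 0) := by
  simp only [level, pow_zero, one_mul, mul_one] at hb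
  refine Submodule.span_induction (p := fun b _ => ∃ c : K,
    vert K G v * b * vert K G w = c • vert K G v ∧ (v ≠ w → c = 0)) ?_ ?_ ?_ ?_ hb
  · rintro _ ⟨u, rfl⟩
    by_cases hu : v = u
    · subst hu
      by_cases hw : v = w
      · subst hw
        exact ⟨1, by rw [vert_mul_self, vert_mul_self, one_smul], fun h => absurd rfl h⟩
      · exact ⟨0, by rw [mul_assoc, vert_mul_ne K G hw, mul_zero, zero_smul], fun _ => rfl⟩
    · exact ⟨0, by rw [vert_mul_ne K G hu, zero_mul, zero_smul], fun _ => rfl⟩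
  · exact ⟨0, by rw [mul_zero, zero_mul, zero_smul], fun _ => rfl⟩
  · rintro x y _ _ ⟨c, hc, hc'⟩ ⟨d, hd, hd'⟩
    exact ⟨c + d, by rw [mul_add, add_mul, hc, hd, add_smul],
      fun h => by rw [hc' h, hd' h, add_zero]⟩
  · rintro a x _ ⟨c, hc, hc'⟩
    exact ⟨a * c, by rw [mul_smul_comm, smul_mul_assoc, hc, mul_smul],
      fun h => by rw [hc' h, mul_zero]⟩

theorem op_smul_smul {M : GrProj (grading K G)} (c : K) (a : LeavittPathAlgebra K G)
    (m : M.carrier) : op (c • a) • m = c • op a • m := by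
  rw [op_smul, smul_assoc]

/-- Coefficients in the span of the vertices can be replaced by scalars. -/
theorem exists_scalar_coeff {M : GrProj (grading K G)} {ι : Type*} [Fintype ι] {v : ι → V}
    {q : ι → M.carrier} (hq : ∀ i, op (vert K G (v i)) • q i = q i)
    {b : ι → LeavittPathAlgebra K G} (hb : ∀ i, b i ∈ level K G 0 0) {w : V}
    (hx : op (vert K G w) • ∑ i, op (b i) • q i = ∑ i, op (b i) • q i) :
    ∃ c : ι → K, (∀ i, vert K G (v i) * b i * vert K G w = c i • vert K G (v i)) ∧
      (∀ i, v i ≠ w → c i = 0) ∧ ∑ i, op (b i) • q i = ∑ i, c i • q i := by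
  choose c hc hc' using fun i => exists_vert_mul_mul_vert (hb i) (v i) w
  refine ⟨c, hc, hc', ?_⟩
  rw [← hx, Finset.smul_sum]
  refine Finset.sum_congr rfl fun i _ => ?_
  conv_lhs => rw [← hq i]
  rw [smul_smul, smul_smul, ← op_mul, ← op_mul, ← mul_assoc, hc, op_smul_smul, hq]

/-! ### Existence of vertex bases -/

theorem sum_edge_mul_ghost_univ (hG : G.NoSinks) :
    ∑ e : E, edge K G e * ghost K G e = 1 := by
  rw [← sum_vert, ← Finset.sum_fiberwise _ G.src]
  exact Finset.sum_congr rfl fun v _ => sum_edge_mul_ghost K G (hG v)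

/-- The submodule generated by the degree `d` component grows with `d`, because `x = ∑ (x e) e*`.
Finite generation makes it everything for some `N`. Finitely many generators of degree `N` are then
split by `1 = ∑ v`. -/
theorem exists_isVertexFamily (hG : G.NoSinks) (M : GrProj (grading K G)) :
    ∃ (N : ℤ) (n : ℕ) (v : Fin n → V) (q : Fin n → M.carrier), IsVertexFamily M N v q := by
  let W : ℤ → Submodule (LeavittPathAlgebra K G)ᵐᵒᵖ M.carrier := fun d =>
    Submodule.span _ (M.comp d : Set M.carrier)
  have hW : Monotone W := monotone_int_of_le_succ fun d => Submodule.span_le.2 fun x hx => by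
    have h : x = ∑ e : E, op (ghost K G e) • op (edge K G e) • x := by
      simp only [smul_smul, ← op_mul]
      rw [← Finset.sum_smul, ← Finset.op_sum, sum_edge_mul_ghost_univ hG, op_one, one_smul]
    rw [h]
    exact sum_mem fun e _ => Submodule.smul_mem _ _
      (Submodule.subset_span (M.smul_mem _ _ _ _ hx (edge_mem K G e)))
  have hx : ∀ x : M.carrier, ∃ d, x ∈ W d := fun x => by
    induction x using M.induction_homogeneous with
    | h0 => exact ⟨0, zero_mem _⟩
    | hom d x hx => exact ⟨d, Submodule.subset_span hx⟩
    | add x y hx hy =>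
      obtain ⟨d, hd⟩ := hx
      obtain ⟨d', hd'⟩ := hy
      exact ⟨max d d', add_mem (hW (le_max_left _ _) hd) (hW (le_max_right _ _) hd')⟩
  have hfin := M.finite
  obtain ⟨n, s, hs⟩ := Module.Finite.exists_fin (R := (LeavittPathAlgebra K G)ᵐᵒᵖ) (M := M.carrier)
  choose d hd using fun i => hx (s i)
  obtain ⟨N, hN⟩ := (Set.finite_range d).bddAbove
  have hT : W N = ⊤ := by
    rw [eq_top_iff, ← hs, Submodule.span_le]
    rintro _ ⟨i, rfl⟩
    exact hW (hN ⟨i, rfl⟩) (hd i)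
  obtain ⟨S, hS, hS'⟩ := (Submodule.fg_span_iff_fg_span_finset_subset _).1
    (show (W N).FG from hT ▸ hfin.fg_top)
  let ε := Fintype.equivFin (S × V)
  -- The family consists of the products `x v`, for `x` in the finite generating set and `v` a
  -- vertex.
  refine ⟨N, _, fun i => (ε.symm i).2,
    fun i => op (vert K G (ε.symm i).2) • ((ε.symm i).1 : M.carrier), fun i => ?_, fun i => ?_, ?_⟩
  · have := M.smul_mem N 0 _ _ (hS (ε.symm i).1.2) (vert_mem K G (ε.symm i).2)
    rwa [add_zero] at this
  · rw [smul_smul, ← op_mul, vert_mul_self]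
  · rw [eq_top_iff, ← hT]
    change Submodule.span _ _ ≤ _
    rw [hS', Submodule.span_le]
    intro x hx
    have h : x = ∑ v : V, op (vert K G v) • x := by
      rw [← Finset.sum_smul, ← Finset.op_sum, sum_vert, op_one, one_smul]
    rw [h]
    refine sum_mem fun v _ => Submodule.subset_span ⟨ε (⟨x, hx⟩, v), ?_⟩
    simp

/-- Projectivity splits the surjection from the free module defined by `q`. The coordinates of a
splitting need not be homogeneous; their parts of degree `-N` still reconstruct every element, and
they take degree zero values on the `q j`. -/
theorem IsVertexFamily.exists_dual {M : GrProj (grading K G)} {N : ℤ} {ι : Type*} [Fintype ι]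
    {v : ι → V} {q : ι → M.carrier} (h : IsVertexFamily M N v q) :
    ∃ s : ι → M.carrier →ₗ[(LeavittPathAlgebra K G)ᵐᵒᵖ] LeavittPathAlgebra K G,
      (∀ i j, s i (q j) ∈ grading K G 0) ∧ ∀ x, x = ∑ i, op (s i x) • q i := by
  have hproj := M.projective
  let π := Fintype.linearCombination (LeavittPathAlgebra K G)ᵐᵒᵖ q
  have hπ : Function.Surjective π := fun x => by
    obtain ⟨a, rfl⟩ := h.exists_coeff x
    exact ⟨fun i => op (a i), Fintype.linearCombination_apply _ _ _⟩
  obtain ⟨σ, hσ⟩ := Module.projective_lifting_property π LinearMap.id hπ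
  have hσ' : ∀ x, x = ∑ i, op (unop (σ x i)) • q i := fun x =>
    (LinearMap.congr_fun hσ x).symm.trans (Fintype.linearCombination_apply _ _ _)
  choose s hs using fun i => M.exists_graded_part
    ((regularEquiv (LeavittPathAlgebra K G)).toLinearMap.comp ((LinearMap.proj i).comp σ)) N
  refine ⟨s, fun i j => ?_, fun x => ?_⟩
  · rw [hs i N _ (h.mem j), sub_self]
    exact SetLike.coe_mem _
  · induction x using M.induction_homogeneous with
    | h0 => simp
    | add x y hx hy =>
      simp only [map_add, op_add, add_smul, Finset.sum_add_distrib]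
      rw [← hx, ← hy]
    | hom d x hx =>
      simp only [hs _ d x hx]
      have h1 := hσ' x
      exact h1.trans (M.sum_smul_eq_of_mem h.mem (h1 ▸ hx))

/-- A maximal `K`-independent subfamily of `q` spans the same vector space, so it still generates.
The dual forms have scalar coefficients on it, and these carry linear independence over `K` to
independence over the algebra. -/
theorem exists_isVertexBasis_of_dual_zero {M : GrProj (grading K G)} {N : ℤ} {ι : Type*}
    [Fintype ι] {v : ι → V} {q : ι → M.carrier} (h : IsVertexFamily M N v q)
    (s : ι → M.carrier →ₗ[(LeavittPathAlgebra K G)ᵐᵒᵖ] LeavittPathAlgebra K G)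
    (hs : ∀ i j, s i (q j) ∈ level K G 0 0) (hx : ∀ x, x = ∑ i, op (s i x) • q i) :
    ∃ (k : ℕ) (w : Fin k → V) (q' : Fin k → M.carrier), IsVertexBasis M N w q' := by
  obtain ⟨κ, a, ha, hspan, hli⟩ := exists_linearIndependent' K q
  have := Finite.of_injective a ha
  have := Fintype.ofFinite κ
  suffices IsVertexBasis M N (v ∘ a) (q ∘ a) from ⟨_, _, _, this.reindex (Fintype.equivFin κ).symm⟩
  refine ⟨⟨fun i => h.mem _, fun i => h.mul_vert _, ?_⟩, fun x hsum => ?_⟩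
  · rw [eq_top_iff, ← h.span, Submodule.span_le]
    rintro _ ⟨i, rfl⟩
    refine Submodule.span_le_restrictScalars K _ _ ?_
    rw [hspan]
    exact Submodule.subset_span ⟨i, rfl⟩
  · have hc := fun k => exists_scalar_coeff h.mul_vert (b := fun i => s i (q (a k)))
      (fun i => hs i _) (w := v (a k)) (by rw [← hx, h.mul_vert])
    choose c hc hc' hcq using hc
    -- Apply `v i * s i` to the assumed relation; the orthogonality of the vertices leaves the
    -- scalars `c k i`.
    have h1 : ∀ i, ∑ k, c k i • (vert K G (v (a k)) * x k) = 0 := by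
      intro i
      have h2 := congrArg (fun y => vert K G (v i) * s i y) hsum
      simp only [map_sum, map_smul, map_zero, mul_zero, Finset.mul_sum] at h2
      rw [← h2]
      refine Finset.sum_congr rfl fun k _ => ?_
      have h3 : s i (q (a k)) * vert K G (v (a k)) = s i (q (a k)) := by
        conv_rhs => rw [← h.mul_vert, map_smul]
        rfl
      change _ = vert K G (v i) * (s i (q (a k)) * x k)
      rw [← mul_assoc, ← h3, ← mul_assoc, hc]
      by_cases hi : v i = v (a k)
      · rw [hi, smul_mul_assoc]
      · rw [hc' k i hi, zero_smul, zero_smul, zero_mul]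
    intro k
    change vert K G (v (a k)) * x k = 0
    -- Linear forms `φ` on the algebra separate points. With `q (a k) = ∑ c k i • q i`, applying `φ`
    -- to `h1` turns the claim into a scalar relation among the independent `q (a k)`.
    rw [← Module.forall_dual_apply_eq_zero_iff K]
    intro φ
    refine Fintype.linearIndependent_iff.1 hli (fun k => φ (vert K G (v (a k)) * x k)) ?_ k
    have h4 : ∀ k, q (a k) = ∑ i, c k i • q i := fun k => (hx _).trans (hcq k)
    simp only [Function.comp_apply]
    rw [Finset.sum_congr rfl fun k _ => congrArg _ (h4 k)]
    simp only [Finset.smul_sum, smul_smul]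
    rw [Finset.sum_comm]
    refine Finset.sum_eq_zero fun i _ => ?_
    rw [← Finset.sum_smul]
    have h5 := congrArg φ (h1 i)
    simp only [map_sum, map_smul, map_zero, smul_eq_mul] at h5
    rw [Finset.sum_congr rfl fun k _ => mul_comm _ _, h5, zero_smul]

/-- Induction on the level of the matrix `s i (q j)`: the push of `q` has dual forms `e* s i`, whose
matrix `e* s i (q j) f` is one level lower. Index types lie in the universe of the edges because a
push pairs indices with edges. -/
theorem exists_isVertexBasis_of_dual (hG : G.NoSinks) {M : GrProj (grading K G)} (n : ℕ) :
    ∀ {N : ℤ} {ι : Type t} [Fintype ι] {v : ι → V} {q : ι → M.carrier}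
      (_ : IsVertexFamily M N v q)
      (s : ι → M.carrier →ₗ[(LeavittPathAlgebra K G)ᵐᵒᵖ] LeavittPathAlgebra K G)
      (_ : ∀ i j, s i (q j) ∈ level K G n n) (_ : ∀ x, x = ∑ i, op (s i x) • q i),
      ∃ (N' : ℤ) (k : ℕ) (w : Fin k → V) (q' : Fin k → M.carrier), IsVertexBasis M N' w q' := by
  induction n with
  | zero =>
    intro N ι _ v q h s hs hx
    exact ⟨N, exists_isVertexBasis_of_dual_zero h s hs hx⟩
  | succ n ih =>
    intro N ι _ v q h s hs hx
    let s' : (Σ i, {e // G.src e = v i}) →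
        M.carrier →ₗ[(LeavittPathAlgebra K G)ᵐᵒᵖ] LeavittPathAlgebra K G := fun p =>
      { toFun := fun x => ghost K G p.2.1 * s p.1 x
        map_add' := fun x y => by rw [map_add, mul_add]
        map_smul' := fun c x => by
          rw [map_smul]
          exact (mul_assoc _ _ _).symm }
    refine ih (h.push hG) s' (fun p r => ?_) fun x => ?_
    · change ghost K G p.2.1 * s p.1 (op (edge K G r.2.1) • q r.1) ∈ _
      rw [map_smul]
      change ghost K G p.2.1 * (s p.1 (q r.1) * edge K G r.2.1) ∈ _
      rw [← mul_assoc]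
      exact ghost_mul_level_mul_edge K G (hs _ _) _ _
    · exact (hx x).trans (sum_push hG h.mul_vert fun i => s i x).symm

theorem exists_vertexBasis (hG : G.NoSinks) (M : GrProj (grading K G)) :
    ∃ (N : ℤ) (n : ℕ) (v : Fin n → V) (q : Fin n → M.carrier), IsVertexBasis M N v q := by
  obtain ⟨N, n, v, q, h⟩ := exists_isVertexFamily hG M
  have h' := h.reindex (κ := ULift.{t} (Fin n)) Equiv.ulift
  obtain ⟨s, hs, hx⟩ := h'.exists_dual
  obtain ⟨m, hm⟩ := exists_forall_mem_level K hG (fun p : _ × _ => s p.1 ((q ∘ Equiv.ulift) p.2))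
    fun p => hs p.1 p.2
  exact exists_isVertexBasis_of_dual hG m h' s (fun i j => hm (i, j)) hx

/-! ### Uniqueness of vertex bases -/

theorem IsVertexBasis.linearIndependent (hG : G.NoSinks) {M : GrProj (grading K G)} {N : ℤ}
    {ι : Type*} [Fintype ι] {v : ι → V} {q : ι → M.carrier} (h : IsVertexBasis M N v q) :
    LinearIndependent K q := by
  refine Fintype.linearIndependent_iff.2 fun c hc i => ?_
  have h1 := h.indep (fun i => c i • 1) (by simpa only [op_smul_smul, op_one, one_smul] using hc) i
  rw [mul_smul_comm, mul_one] at h1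
  exact (smul_eq_zero.1 h1).resolve_right (vert_ne_zero K hG _)

/-- Scalar coefficients vanish between different vertices, so a level zero change of family respects
the `K`-span attached to each vertex. -/
theorem span_vertex_le {M : GrProj (grading K G)} {ι κ : Type*} [Fintype ι] {v : ι → V}
    {q : ι → M.carrier} (hq : ∀ i, op (vert K G (v i)) • q i = q i) {w : κ → V}
    {q' : κ → M.carrier} (hq' : ∀ j, op (vert K G (w j)) • q' j = q' j)
    {a : κ → ι → LeavittPathAlgebra K G} (ha : ∀ j i, a j i ∈ level K G 0 0)
    (h : ∀ j, q' j = ∑ i, op (a j i) • q i) (u : V) :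
    Submodule.span K (Set.range fun j : {j // w j = u} => q' j) ≤
      Submodule.span K (Set.range fun i : {i // v i = u} => q i) := by
  rw [Submodule.span_le]
  rintro _ ⟨⟨j, rfl⟩, rfl⟩
  obtain ⟨c, -, hc, hcq⟩ := exists_scalar_coeff hq (ha j) (w := w j) (by rw [← h, hq'])
  change q' j ∈ _
  rw [h, hcq]
  refine sum_mem fun i _ => ?_
  by_cases hi : v i = w j
  · exact Submodule.smul_mem _ _ (Submodule.subset_span ⟨⟨i, hi⟩, rfl⟩)
  · rw [hc i hi, zero_smul]
    exact zero_mem _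

theorem push_coeff (hG : G.NoSinks) {M : GrProj (grading K G)} {ι κ : Type*} [Fintype ι]
    {v : ι → V} {q : ι → M.carrier} (hq : ∀ i, op (vert K G (v i)) • q i = q i) {w : κ → V}
    {q' : κ → M.carrier} {a : κ → ι → LeavittPathAlgebra K G}
    (h : ∀ j, q' j = ∑ i, op (a j i) • q i) (r : Σ j, {e // G.src e = w j}) :
    pushFamily M w q' r = ∑ p : Σ i, {e // G.src e = v i},
      op (ghost K G p.2.1 * a r.1 p.1 * edge K G r.2.1) • pushFamily M v q p := by
  rw [pushFamily, h, ← sum_push hG hq, Finset.smul_sum]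
  refine Finset.sum_congr rfl fun p _ => ?_
  rw [smul_smul, ← op_mul]

/-- At level zero, the members of both bases attached to a vertex `u` are independent and have the
same `K`-span, so they are equally many. Each push lowers the level of both transition matrices and
multiplies both counts by the adjacency matrix. -/
theorem vertexCount_eq_of_coeff (hG : G.NoSinks) {M : GrProj (grading K G)} (n : ℕ) :
    ∀ {N : ℤ} {ι κ : Type t} [Fintype ι] [Fintype κ] {v : ι → V} {q : ι → M.carrier}
      (_ : IsVertexBasis M N v q) {w : κ → V} {q' : κ → M.carrier} (_ : IsVertexBasis M N w q')
      {a : κ → ι → LeavittPathAlgebra K G} (_ : ∀ j i, a j i ∈ level K G n n)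
      (_ : ∀ j, q' j = ∑ i, op (a j i) • q i)
      {b : ι → κ → LeavittPathAlgebra K G} (_ : ∀ i j, b i j ∈ level K G n n)
      (_ : ∀ i, q i = ∑ j, op (b i j) • q' j),
      Matrix.vecMul (vertexCount v) (G.adjMatrix ^ n) =
        Matrix.vecMul (vertexCount w) (G.adjMatrix ^ n) := by
  induction n with
  | zero =>
    intro N ι κ _ _ v q h w q' h' a ha hqa b hb hqb
    rw [pow_zero, Matrix.vecMul_one, Matrix.vecMul_one]
    ext u
    rw [vertexCount_apply, vertexCount_apply]
    have h1 := (h.linearIndependent hG).comp (fun i : {i // v i = u} => i.1) Subtype.val_injective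
    have h2 := (h'.linearIndependent hG).comp (fun i : {i // w i = u} => i.1)
      Subtype.val_injective
    rw [← finrank_span_eq_card h1, ← finrank_span_eq_card h2]
    have h3 := le_antisymm (span_vertex_le h'.mul_vert h.mul_vert hb hqb u)
      (span_vertex_le h.mul_vert h'.mul_vert ha hqa u)
    exact congrArg (fun S : Submodule K M.carrier => Module.finrank K S) h3
  | succ n ih =>
    intro N ι κ _ _ v q h w q' h' a ha hqa b hb hqb
    have := ih (h.push hG) (h'.push hG)
      (fun r p => ghost_mul_level_mul_edge K G (ha r.1 p.1) p.2.1 r.2.1)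
      (push_coeff hG h.mul_vert hqa)
      (fun r p => ghost_mul_level_mul_edge K G (hb r.1 p.1) p.2.1 r.2.1)
      (push_coeff hG h'.mul_vert hqb)
    rwa [vertexCount_push, vertexCount_push, Matrix.vecMul_vecMul, Matrix.vecMul_vecMul,
      ← pow_succ'] at this

theorem IsVertexBasis.exists_coeff_grading {M : GrProj (grading K G)} {N : ℤ} {ι : Type*}
    [Fintype ι] {v : ι → V} {q : ι → M.carrier} (h : IsVertexBasis M N v q) {x : M.carrier}
    (hx : x ∈ M.comp N) :
    ∃ a : ι → LeavittPathAlgebra K G, (∀ i, a i ∈ grading K G 0) ∧ x = ∑ i, op (a i) • q i := by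
  obtain ⟨a, rfl⟩ := h.exists_coeff x
  refine ⟨_, fun i => ?_, M.sum_smul_eq_of_mem h.mem hx⟩
  rw [sub_self]
  exact SetLike.coe_mem _

theorem IsVertexBasis.vertexCount_eq (hG : G.NoSinks) {M : GrProj (grading K G)} {N : ℤ}
    {m k : ℕ} {v : Fin m → V} {q : Fin m → M.carrier} (h : IsVertexBasis M N v q)
    {w : Fin k → V} {q' : Fin k → M.carrier} (h' : IsVertexBasis M N w q') :
    ∃ n, Matrix.vecMul (vertexCount v) (G.adjMatrix ^ n) =
        Matrix.vecMul (vertexCount w) (G.adjMatrix ^ n) := by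
  choose a ha hqa using fun j => h.exists_coeff_grading (h'.mem j)
  choose b hb hqb using fun i => h'.exists_coeff_grading (h.mem i)
  obtain ⟨n₁, hn₁⟩ := exists_forall_mem_level K hG (fun p : _ × _ => a p.1 p.2)
    fun p => ha p.1 p.2
  obtain ⟨n₂, hn₂⟩ := exists_forall_mem_level K hG (fun p : _ × _ => b p.1 p.2)
    fun p => hb p.1 p.2
  refine ⟨max n₁ n₂, ?_⟩
  have := vertexCount_eq_of_coeff hG (max n₁ n₂) (h.reindex (κ := ULift.{t} (Fin m)) Equiv.ulift)
    (h'.reindex (κ := ULift.{t} (Fin k)) Equiv.ulift) (a := fun j i => a j.down i.down)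
    (fun j i => level_diag_mono K hG (le_max_left n₁ n₂) (hn₁ (j.down, i.down)))
    (fun j => (hqa j.down).trans (Equiv.ulift.sum_comp _).symm)
    (b := fun j i => b j.down i.down)
    (fun j i => level_diag_mono K hG (le_max_right n₁ n₂) (hn₂ (j.down, i.down)))
    (fun j => (hqb j.down).trans (Equiv.ulift.sum_comp _).symm)
  rwa [vertexCount_comp_equiv, vertexCount_comp_equiv] at this

end LeavittPathAlgebra

end

noncomputable section

open LaurentPolynomial

/-! ### Dimension groups of matrices of natural numbers. -/

section Combination

variable {V : Type*} [Fintype V] {M : Type*} [AddCommGroup M]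

/-- The integral linear combination of a finite family. -/
abbrev intComb (b : V → M) : (V → ℤ) →ₗ[ℤ] M := Fintype.linearCombination ℤ b

theorem intComb_single [DecidableEq V] (b : V → M) (v : V) : intComb b (Pi.single v 1) = b v := by
  rw [Fintype.linearCombination_apply_single, one_smul]

variable [Module ℤ[T;T⁻¹] M]

theorem laurent_smul_zsmul (p : ℤ[T;T⁻¹]) (n : ℤ) (x : M) : p • n • x = n • p • x :=
  (DistribSMul.toAddMonoidHom M p).map_zsmul n x

theorem C_mul_T_smul (a n : ℤ) (x : M) :
    (LaurentPolynomial.C a * T n : ℤ[T;T⁻¹]) • x = a • (T n : ℤ[T;T⁻¹]) • x := by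
  rw [mul_smul, eq_intCast (LaurentPolynomial.C (R := ℤ)) a, Int.cast_smul_eq_zsmul]

/-- The defining relations `x v = ∑ A v w w` of the dimension group of a matrix. -/
def DimensionRel (A : Matrix V V ℕ) (b : V → M) : Prop :=
  ∀ v, (T 1 : ℤ[T;T⁻¹]) • b v = ∑ w, A v w • b w

namespace DimensionRel

variable {A : Matrix V V ℕ} {b : V → M}

theorem T_one_smul_intComb (h : DimensionRel A b) (c : V → ℤ) :
    (T 1 : ℤ[T;T⁻¹]) • intComb b c = intComb b (Matrix.vecMul c (A.map (Nat.cast : ℕ → ℤ))) := by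
  simp only [Fintype.linearCombination_apply, Finset.smul_sum, laurent_smul_zsmul, h _,
    Matrix.vecMul, dotProduct, Finset.sum_smul, mul_smul, Matrix.map_apply, natCast_zsmul]
  exact Finset.sum_comm

variable [DecidableEq V]

theorem T_smul_intComb (h : DimensionRel A b) (c : V → ℤ) (n : ℕ) :
    (T n : ℤ[T;T⁻¹]) • intComb b c =
      intComb b (Matrix.vecMul c (A.map (Nat.cast : ℕ → ℤ) ^ n)) := by
  induction n with
  | zero => rw [Nat.cast_zero, T_zero, one_smul, pow_zero, Matrix.vecMul_one]
  | succ n ih =>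
    rw [Nat.cast_succ, add_comm, T_add, mul_smul, ih, h.T_one_smul_intComb, Matrix.vecMul_vecMul,
      ← pow_succ]

theorem smul_intComb_eq (h : DimensionRel A b) (c : V → ℤ) (n : ℤ) (k : ℕ) :
    (T n : ℤ[T;T⁻¹]) • intComb b c =
      (T (n - k) : ℤ[T;T⁻¹]) • intComb b (Matrix.vecMul c (A.map (Nat.cast : ℕ → ℤ) ^ k)) := by
  rw [← h.T_smul_intComb, smul_smul, ← T_add, sub_add_cancel]

/-- Powers of `x` serve as denominators: the relations absorb nonnegative powers into the
coefficients, and two elements can be brought to a common denominator. -/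
theorem exists_eq_smul_intComb (h : DimensionRel A b)
    (hs : Submodule.span ℤ[T;T⁻¹] (Set.range b) = ⊤) (x : M) :
    ∃ (n : ℕ) (c : V → ℤ), x = (T (-n) : ℤ[T;T⁻¹]) • intComb b c := by
  have hadd : ∀ x y : M, (∃ (n : ℕ) (c : V → ℤ), x = (T (-n) : ℤ[T;T⁻¹]) • intComb b c) →
      (∃ (n : ℕ) (c : V → ℤ), y = (T (-n) : ℤ[T;T⁻¹]) • intComb b c) →
      ∃ (n : ℕ) (c : V → ℤ), x + y = (T (-n) : ℤ[T;T⁻¹]) • intComb b c := by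
    rintro _ _ ⟨n, c, rfl⟩ ⟨m, d, rfl⟩
    refine ⟨n + m, Matrix.vecMul c (A.map (Nat.cast : ℕ → ℤ) ^ m) +
      Matrix.vecMul d (A.map (Nat.cast : ℕ → ℤ) ^ n), ?_⟩
    rw [h.smul_intComb_eq c (-n) m, h.smul_intComb_eq d (-m) n, sub_eq_add_neg, sub_eq_add_neg,
      add_comm (-(m : ℤ)), ← smul_add, ← map_add, Nat.cast_add, neg_add]
  have hx : x ∈ Submodule.span ℤ[T;T⁻¹] (Set.range b) := hs ▸ Submodule.mem_top
  refine Submodule.span_induction (p := fun x _ =>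
    ∃ (n : ℕ) (c : V → ℤ), x = (T (-n) : ℤ[T;T⁻¹]) • intComb b c) ?_ ?_ ?_ ?_ hx
  · rintro _ ⟨v, rfl⟩
    exact ⟨0, Pi.single v 1, by rw [intComb_single, Nat.cast_zero, neg_zero, T_zero, one_smul]⟩
  · exact ⟨0, 0, by rw [map_zero, smul_zero]⟩
  · exact fun x y _ _ => hadd x y
  · intro p x _ hx
    induction p using LaurentPolynomial.induction_on' with
    | add p q hp hq =>
      rw [add_smul]
      exact hadd _ _ hp hq
    | C_mul_T n a =>
      obtain ⟨m, c, rfl⟩ := hx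
      -- The positive part of `n` is absorbed by a power of `A`, the negative part joins the
      -- denominator.
      refine ⟨(-n).toNat + m, a • Matrix.vecMul c (A.map (Nat.cast : ℕ → ℤ) ^ n.toNat), ?_⟩
      rw [C_mul_T_smul, smul_smul, ← T_add, h.smul_intComb_eq c _ n.toNat, map_smul,
        laurent_smul_zsmul]
      congr 3
      omega

end DimensionRel

/-- A pre-ordered `ℤ[x, x⁻¹]`-module with positive cone `C` is the dimension group of the matrix
`A`, with canonical generators `b`. -/
structure IsDimensionGroup [DecidableEq V] (A : Matrix V V ℕ) (C : AddSubmonoid M) (b : V → M) :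
    Prop where
  rel : DimensionRel A b
  cone_eq : C = AddSubmonoid.closure {x | ∃ (n : ℤ) (v : V), (T n : ℤ[T;T⁻¹]) • b v = x}
  span : Submodule.span ℤ[T;T⁻¹] (Set.range b) = ⊤
  ker : ∀ c : V → ℤ, intComb b c = 0 → ∃ n, Matrix.vecMul c (A.map (Nat.cast : ℕ → ℤ) ^ n) = 0

namespace IsDimensionGroup

variable [DecidableEq V] {A : Matrix V V ℕ} {C : AddSubmonoid M} {b : V → M}

/-- The kernel condition says that every relation among the `b v` is forced by `DimensionRel`: a
coefficient vector killed by a power of `A` gives zero in any module that satisfies these relations.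
-/
theorem bijective_of_rel (h : IsDimensionGroup A C b) {P : Type*} [AddCommGroup P]
    [Module ℤ[T;T⁻¹] P] {b' : V → P} (h' : DimensionRel A b')
    (hs : Submodule.span ℤ[T;T⁻¹] (Set.range b') = ⊤) (f : P →ₗ[ℤ[T;T⁻¹]] M)
    (hf : ∀ v, f (b' v) = b v) : Function.Bijective f := by
  constructor
  · refine (injective_iff_map_eq_zero f).2 fun x hx => ?_
    obtain ⟨n, c, rfl⟩ := h'.exists_eq_smul_intComb hs x
    have h1 : f (intComb b' c) = intComb b c := by
      simp only [Fintype.linearCombination_apply, map_sum, map_zsmul, hf]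
    have h2 := congrArg (fun y => (T n : ℤ[T;T⁻¹]) • y) hx
    simp only [map_smul, h1, smul_smul, ← T_add, add_neg_cancel, T_zero, one_smul,
      smul_zero] at h2
    obtain ⟨k, hk⟩ := h.ker c h2
    rw [h'.smul_intComb_eq c _ k, hk, map_zero, smul_zero]
  · rw [← LinearMap.range_eq_top, eq_top_iff, ← h.span, Submodule.span_le]
    rintro _ ⟨v, rfl⟩
    exact ⟨b' v, hf v⟩

/-- Dimension groups of the same matrix are isomorphic. -/
theorem exists_linearEquiv (h : IsDimensionGroup A C b) {M' : Type*} [AddCommGroup M']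
    [Module ℤ[T;T⁻¹] M'] {C' : AddSubmonoid M'} {b' : V → M'} (h' : IsDimensionGroup A C' b') :
    ∃ Φ : M ≃ₗ[ℤ[T;T⁻¹]] M', (∀ z, z ∈ C ↔ Φ z ∈ C') ∧ ∀ v, Φ (b v) = b' v := by
  -- This submodule will be the graph of the isomorphism: both projections are bijective on it.
  let P := Submodule.span ℤ[T;T⁻¹] (Set.range fun v => (b v, b' v))
  let p : V → P := fun v => ⟨(b v, b' v), Submodule.subset_span ⟨v, rfl⟩⟩
  have hp : DimensionRel A p := fun v => Subtype.ext (Prod.ext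
    ((h.rel v).trans (by simp [p, Prod.fst_sum])) ((h'.rel v).trans (by simp [p, Prod.snd_sum])))
  have hs : Submodule.span ℤ[T;T⁻¹] (Set.range p) = ⊤ := by
    refine Submodule.map_injective_of_injective P.subtype_injective ?_
    rw [Submodule.map_span, ← Set.range_comp, Submodule.map_top, Submodule.range_subtype]
    rfl
  let e := LinearEquiv.ofBijective _ (h.bijective_of_rel hp hs
    ((LinearMap.fst ℤ[T;T⁻¹] M M').comp P.subtype) fun v => rfl)
  let e' := LinearEquiv.ofBijective _ (h'.bijective_of_rel hp hs
    ((LinearMap.snd ℤ[T;T⁻¹] M M').comp P.subtype) fun v => rfl)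
  have hΦ : ∀ v, e.symm.trans e' (b v) = b' v := fun v => by
    have : e.symm (b v) = p v := e.symm_apply_eq.2 rfl
    rw [LinearEquiv.trans_apply, this]
    rfl
  refine ⟨e.symm.trans e', fun z => ?_, hΦ⟩
  have hC : C' = C.map (e.symm.trans e').toLinearMap.toAddMonoidHom := by
    rw [h.cone_eq, h'.cone_eq, AddMonoidHom.map_mclosure]
    congr 1
    ext x
    constructor
    · rintro ⟨n, v, rfl⟩
      exact ⟨_, ⟨n, v, rfl⟩, by
        rw [← hΦ]
        exact (e.symm.trans e').map_smul _ _⟩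
    · rintro ⟨_, ⟨n, v, rfl⟩, rfl⟩
      exact ⟨n, v, by
        rw [← hΦ]
        exact ((e.symm.trans e').map_smul _ _).symm⟩
  rw [hC]
  constructor
  · exact fun hz => ⟨z, hz, rfl⟩
  · rintro ⟨y, hy, hyz⟩
    rwa [← (e.symm.trans e').injective hyz]

/-- If a nonzero multiple of `c` is killed by a power of `A`, then so is `c`, as `ℤ^V` is
torsion-free. -/
theorem isTorsionFree (h : IsDimensionGroup A C b) : Module.IsTorsionFree ℤ M := by
  refine Module.IsTorsionFree.of_smul_eq_zero fun a x hx => or_iff_not_imp_left.2 fun ha => ?_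
  obtain ⟨n, c, rfl⟩ := h.rel.exists_eq_smul_intComb h.span x
  have h2 := congrArg (fun y => (T n : ℤ[T;T⁻¹]) • y) hx
  simp only [smul_zero, laurent_smul_zsmul, smul_smul, ← T_add, add_neg_cancel, T_zero,
    one_smul] at h2
  rw [← map_smul] at h2
  obtain ⟨k, hk⟩ := h.ker _ h2
  rw [Matrix.smul_vecMul, smul_eq_zero] at hk
  rw [h.rel.smul_intComb_eq c _ k, hk.resolve_left ha, map_zero, smul_zero]

theorem smul_mem (h : IsDimensionGroup A C b) (n : ℤ) (v : V) :
    (T n : ℤ[T;T⁻¹]) • b v ∈ C := by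
  rw [h.cone_eq]
  exact AddSubmonoid.subset_closure ⟨n, v, rfl⟩

end IsDimensionGroup

/-- Since `A` has nonnegative entries, higher powers of `x` applied to generators are positive
combinations of lower ones. Positive elements of two factors can thus be moved to a common degree.
-/
theorem DimensionRel.smul_mem_closure {A : Matrix V V ℕ} {b : V → M} (h : DimensionRel A b) (n : ℤ)
    (k : ℕ) (v : V) : (T (n + k) : ℤ[T;T⁻¹]) • b v ∈
      AddSubmonoid.closure (Set.range fun w => (T n : ℤ[T;T⁻¹]) • b w) := by
  induction k generalizing n v with
  | zero =>
    rw [Nat.cast_zero, add_zero]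
    exact AddSubmonoid.subset_closure ⟨v, rfl⟩
  | succ k ih =>
    rw [Nat.cast_succ, ← add_assoc, T_add, mul_smul, h, Finset.smul_sum]
    refine sum_mem fun w _ => ?_
    rw [smul_comm]
    exact nsmul_mem (ih n w) _

theorem DimensionRel.smul_mem_closure_of_le {A : Matrix V V ℕ} {b : V → M} (h : DimensionRel A b)
    {n m : ℤ} (hnm : n ≤ m) (v : V) : (T m : ℤ[T;T⁻¹]) • b v ∈
      AddSubmonoid.closure (Set.range fun w => (T n : ℤ[T;T⁻¹]) • b w) := by
  obtain ⟨k, rfl⟩ := Int.le.dest hnm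
  exact h.smul_mem_closure n k v

end Combination

/-! ### Tensor products of dimension groups -/

theorem Matrix.kronecker_map_natCast {V W : Type*} (A : Matrix V V ℕ) (B : Matrix W W ℕ) :
    (A ⊗ₖ B).map (Nat.cast : ℕ → ℤ) =
      A.map (Nat.cast : ℕ → ℤ) ⊗ₖ B.map (Nat.cast : ℕ → ℤ) := by
  ext ⟨i, j⟩ ⟨k, l⟩
  simp

theorem exists_forall_vecMul_pow_eq_zero {V κ : Type*} [Fintype V] [DecidableEq V] [Finite κ]
    (A : Matrix V V ℤ) (c : κ → V → ℤ) (h : ∀ j, ∃ n, Matrix.vecMul (c j) (A ^ n) = 0) :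
    ∃ n, ∀ j, Matrix.vecMul (c j) (A ^ n) = 0 := by
  choose n hn using h
  obtain ⟨N, hN⟩ := (Set.finite_range n).bddAbove
  refine ⟨N, fun j => ?_⟩
  rw [← Nat.add_sub_cancel' (hN ⟨j, rfl⟩), pow_add, ← Matrix.vecMul_vecMul, hn,
    Matrix.zero_vecMul]

section Tensor

variable {V W : Type*} [Fintype V] [Fintype W]
  {M N : Type*} [AddCommGroup M] [AddCommGroup N]

/-- Pure tensors, as a bilinear map to the tensor product with the diagonal action. -/
def diagMk (M N : Type*) [AddCommGroup M] [AddCommGroup N] : M →+ N →+ DiagTensor M N where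
  toFun x :=
    { toFun := fun y => DiagTensor.tmul x y
      map_zero' := TensorProduct.tmul_zero N x
      map_add' := TensorProduct.tmul_add x }
  map_zero' := AddMonoidHom.ext fun y => TensorProduct.zero_tmul M y
  map_add' x x' := AddMonoidHom.ext fun y => TensorProduct.add_tmul x x' y

theorem diagMk_apply (x : M) (y : N) : diagMk M N x y = DiagTensor.tmul x y := rfl

theorem diagMk_mem_closure {s : Set M} {t : Set N} {S : AddSubmonoid (DiagTensor M N)}
    (hst : ∀ x ∈ s, ∀ y ∈ t, DiagTensor.tmul x y ∈ S) {x : M} {y : N}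
    (hx : x ∈ AddSubmonoid.closure s) (hy : y ∈ AddSubmonoid.closure t) :
    DiagTensor.tmul x y ∈ S := by
  rw [← diagMk_apply]
  induction hx using AddSubmonoid.closure_induction with
  | mem x hx =>
    induction hy using AddSubmonoid.closure_induction with
    | mem y hy => exact hst x hx y hy
    | zero => simp
    | add y y' _ _ h h' =>
      rw [map_add]
      exact add_mem h h'
  | zero => simp
  | add x x' _ _ h h' =>
    rw [map_add]
    exact add_mem h h'

theorem sum_smul_tmul {b : V → M} {d : W → N} (c : V × W → ℤ) :
    intComb (fun p : V × W => DiagTensor.tmul (b p.1) (d p.2)) c =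
      ∑ v, DiagTensor.tmul (b v) (intComb d fun w => c (v, w)) := by
  rw [Fintype.linearCombination_apply, Fintype.sum_prod_type]
  refine Finset.sum_congr rfl fun v _ => ?_
  rw [Fintype.linearCombination_apply, ← diagMk_apply, map_sum]
  exact Finset.sum_congr rfl fun w _ => ((diagMk M N (b v)).map_zsmul _ _).symm

variable [Module ℤ[T;T⁻¹] M] [Module ℤ[T;T⁻¹] N]
  {A : Matrix V V ℕ} {B : Matrix W W ℕ} {C : AddSubmonoid M} {D : AddSubmonoid N}
  {b : V → M} {d : W → N}

theorem DimensionRel.tensor (hb : DimensionRel A b) (hd : DimensionRel B d) :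
    DimensionRel (A ⊗ₖ B) fun p : V × W => DiagTensor.tmul (b p.1) (d p.2) := by
  rintro ⟨v, w⟩
  rw [DiagTensor.T_smul_tmul, hb, hd, ← diagMk_apply, map_sum (diagMk M N), Fintype.sum_prod_type,
    AddMonoidHom.finsetSum_apply]
  refine Finset.sum_congr rfl fun v' _ => ?_
  rw [map_sum]
  refine Finset.sum_congr rfl fun w' _ => ?_
  rw [map_nsmul, map_nsmul, Matrix.kronecker_apply, mul_comm, mul_smul]
  rfl

variable [DecidableEq V] [DecidableEq W]

theorem Matrix.kronecker_pow_eq (A : Matrix V V ℤ) (B : Matrix W W ℤ) (n : ℕ) :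
    (A ⊗ₖ B) ^ n = (A ^ n) ⊗ₖ (B ^ n) := by
  induction n with
  | zero => simp
  | succ n ih => rw [pow_succ, ih, pow_succ, pow_succ, Matrix.mul_kronecker_mul]

/-- As `N` is flat over `ℤ`, a vanishing sum of tensors vanishes trivially: the right factors are
combinations of some `y j` whose matrix `a` gives relations among the `b v`. A power of `A` kills
those relations, and then a power of `B` kills what remains. -/
theorem IsDimensionGroup.tensor_ker (hb : IsDimensionGroup A C b) (hd : IsDimensionGroup B D d)
    (c : V × W → ℤ)
    (hc : intComb (fun p : V × W => DiagTensor.tmul (b p.1) (d p.2)) c = 0) :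
    ∃ n, Matrix.vecMul c ((A ⊗ₖ B).map (Nat.cast : ℕ → ℤ) ^ n) = 0 := by
  set A' := A.map (Nat.cast : ℕ → ℤ)
  set B' := B.map (Nat.cast : ℕ → ℤ)
  have := hd.isTorsionFree
  rw [sum_smul_tmul] at hc
  obtain ⟨k, a, y, hy, ha⟩ :=
    TensorProduct.vanishesTrivially_of_sum_tmul_eq_zero_of_rTensor_injective ℤ
      (Module.Flat.rTensor_preserves_injective_linearMap (M := N) _
        (Submodule.injective_subtype _)) hc
  obtain ⟨n, hn⟩ := exists_forall_vecMul_pow_eq_zero A' (fun j v => a v j)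
    fun j => hb.ker _ (ha j)
  -- The matrix `c` after the action of `A' ^ n` on the first index; its rows are relations among
  -- the `d w`.
  let e : V → W → ℤ := fun u w => ∑ v, (A' ^ n) v u * c (v, w)
  have he : ∀ u, intComb d (e u) = 0 := by
    intro u
    have h1 : e u = ∑ v, (A' ^ n) v u • fun w => c (v, w) := by
      ext w
      simp [e]
    rw [h1, map_sum]
    simp only [map_smul, hy, Finset.smul_sum, smul_smul]
    rw [Finset.sum_comm]
    refine Finset.sum_eq_zero fun j _ => ?_
    rw [← Finset.sum_smul]
    have h2 := congrFun (hn j) u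
    simp only [Matrix.vecMul, dotProduct, Pi.zero_apply] at h2
    rw [Finset.sum_congr rfl fun v _ => mul_comm _ _, h2, zero_smul]
  obtain ⟨m, hm⟩ := exists_forall_vecMul_pow_eq_zero B' e fun u => hd.ker _ (he u)
  refine ⟨n + m, ?_⟩
  have h3 : Matrix.vecMul c ((A' ^ n) ⊗ₖ (B' ^ m)) = 0 := by
    ext ⟨u, w⟩
    have h4 := congrFun (hm u) w
    simp only [Matrix.vecMul, dotProduct, Pi.zero_apply, e, Finset.sum_mul] at h4
    simp only [Matrix.vecMul, dotProduct, Pi.zero_apply, Fintype.sum_prod_type,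
      Matrix.kronecker_apply]
    rw [Finset.sum_comm, ← h4]
    exact Finset.sum_congr rfl fun x _ => Finset.sum_congr rfl fun v _ => by ring
  rw [Matrix.kronecker_map_natCast, Matrix.kronecker_pow_eq, pow_add, add_comm n m, pow_add,
    Matrix.mul_kronecker_mul,
    ← Matrix.vecMul_vecMul, h3, Matrix.zero_vecMul]

theorem IsDimensionGroup.tensor (hb : IsDimensionGroup A C b) (hd : IsDimensionGroup B D d) :
    IsDimensionGroup (A ⊗ₖ B) (DiagTensor.cone C D)
      fun p : V × W => DiagTensor.tmul (b p.1) (d p.2) := by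
  refine ⟨hb.rel.tensor hd.rel, le_antisymm ?_ ?_, ?_, hb.tensor_ker hd⟩
  · refine AddSubmonoid.closure_le.2 ?_
    rintro _ ⟨x, hx, y, hy, rfl⟩
    rw [hb.cone_eq] at hx
    rw [hd.cone_eq] at hy
    refine diagMk_mem_closure ?_ hx hy
    rintro _ ⟨n, v, rfl⟩ _ ⟨m, w, rfl⟩
    -- The diagonal action requires both factors to carry the same power of `x`, so both are written
    -- in degree `min n m`.
    refine diagMk_mem_closure ?_ (hb.rel.smul_mem_closure_of_le (min_le_left n m) v)
      (hd.rel.smul_mem_closure_of_le (min_le_right n m) w)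
    rintro _ ⟨v, rfl⟩ _ ⟨w, rfl⟩
    exact AddSubmonoid.subset_closure ⟨min n m, (v, w), DiagTensor.T_smul_tmul _ _ _ _ _⟩
  · refine AddSubmonoid.closure_le.2 ?_
    rintro _ ⟨n, ⟨v, w⟩, rfl⟩
    rw [DiagTensor.T_smul_tmul]
    exact AddSubmonoid.subset_closure ⟨_, hb.smul_mem n v, _, hd.smul_mem n w, rfl⟩
  · set S := Submodule.span ℤ[T;T⁻¹] (Set.range fun p : V × W => DiagTensor.tmul (b p.1) (d p.2))
    rw [eq_top_iff]
    rintro z -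
    induction z using TensorProduct.induction_on with
    | zero => exact zero_mem _
    | add x y hx hy => exact add_mem hx hy
    | tmul x y =>
      obtain ⟨n, c, rfl⟩ := hb.rel.exists_eq_smul_intComb hb.span x
      obtain ⟨m, e, rfl⟩ := hd.rel.exists_eq_smul_intComb hd.span y
      -- Both factors are brought to the common denominator `x ^ (n + m)`.
      rw [hb.rel.smul_intComb_eq c _ m, hd.rel.smul_intComb_eq e _ n]
      have h : (-n - m : ℤ) = -m - n := by ring
      rw [h]
      change DiagTensor.tmul _ _ ∈ S
      rw [← DiagTensor.T_smul_tmul, ← diagMk_apply]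
      refine Submodule.smul_mem _ _ ?_
      rw [Fintype.linearCombination_apply, Fintype.linearCombination_apply, map_sum (diagMk M N),
        AddMonoidHom.finsetSum_apply]
      refine sum_mem fun v _ => ?_
      rw [map_sum]
      refine sum_mem fun w _ => ?_
      rw [map_zsmul, map_zsmul]
      exact S.toAddSubgroup.zsmul_mem
        (S.toAddSubgroup.zsmul_mem (Submodule.subset_span ⟨(v, w), rfl⟩) _) _

end Tensor

end

noncomputable section

/-! ### Elements and equality in the group completion. -/

namespace K0gr

open LaurentPolynomial

variable {K A : Type*} [Field K] [Ring A] [Algebra K A] (𝒜 : ℤ → Submodule K A)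

theorem of_shift (n : ℤ) (x : VGr 𝒜) :
    of 𝒜 (VGr.shift n x) = (T n : ℤ[T;T⁻¹]) • of 𝒜 x := by
  obtain ⟨M, rfl⟩ := Quotient.exists_rep x
  exact (T_smul_cls 𝒜 n M).symm

theorem exists_add_eq_of_of_eq {x y : VGr 𝒜} (h : of 𝒜 x = of 𝒜 y) : ∃ z, x + z = y + z := by
  have h' : AddLocalization.mk x (0 : (⊤ : AddSubmonoid (VGr 𝒜))) = AddLocalization.mk y 0 := h
  rw [AddLocalization.mk_eq_mk_iff, AddLocalization.r_iff_exists] at h'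
  obtain ⟨c, hc⟩ := h'
  refine ⟨c, ?_⟩
  simpa [add_comm] using hc

theorem exists_sub (x : K0gr 𝒜) : ∃ y z, x = of 𝒜 y - of 𝒜 z := by
  induction x using AddLocalization.induction_on with
  | H p =>
    refine ⟨p.1, p.2.1, ?_⟩
    refine (eq_sub_iff_add_eq (G := K0gr 𝒜)).2 ?_
    refine (AddLocalization.mk_add _ _ _ _).trans ?_
    change _ = AddLocalization.mk p.1 0
    rw [AddLocalization.mk_eq_mk_iff, AddLocalization.r_iff_exists]
    exact ⟨0, by simp [add_comm]⟩

end K0gr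

/-! ### The graded Grothendieck group as a dimension group. -/

namespace LeavittPathAlgebra

open MulOpposite GrProj LaurentPolynomial

variable {K V E : Type*} [Field K] [DecidableEq V] [Fintype V] [Fintype E]
  {G : DirGraph V E}

/-- The class of the module generated by a vertex in the graded Grothendieck group. -/
def vertexClass (K : Type*) [Field K] (G : DirGraph V E) (v : V) : K0gr (grading K G) :=
  K0gr.cls (vertexModule K G v)

theorem sum_comp_eq_intComb {ι M : Type*} [Fintype ι] [AddCommGroup M] (b : V → M) (v : ι → V) :
    ∑ i, b (v i) = intComb b fun u => (vertexCount v u : ℤ) := by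
  have : (fun u => (vertexCount v u : ℤ)) = ∑ i, Pi.single (v i) (1 : ℤ) := by
    ext u
    simp [vertexCount, Finset.sum_apply, Pi.single_apply]
  rw [this, map_sum]
  exact Finset.sum_congr rfl fun i _ => (intComb_single b (v i)).symm

theorem IsVertexBasis.cls_eq {M : GrProj (grading K G)} {N : ℤ} {ι : Type*} [Fintype ι]
    {v : ι → V} {q : ι → M.carrier} (h : IsVertexBasis M N v q) :
    K0gr.cls M = (T (-N) : ℤ[T;T⁻¹]) • ∑ i, vertexClass K G (v i) := by
  rw [K0gr.cls, h.mk_eq_sum, map_sum, Finset.smul_sum]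
  exact Finset.sum_congr rfl fun i _ => K0gr.of_shift _ _ _

/-- The module `v L` has the basis `v` in degree zero and, after a push, the edges leaving `v` in
degree one. Comparison of the two resulting classes is the relation. -/
theorem dimensionRel_vertexClass (hG : G.NoSinks) :
    DimensionRel G.adjMatrix (vertexClass K G) := by
  intro v
  have h := isVertexBasis_vertexModule (K := K) (G := G) 0 v
  have h1 := h.cls_eq.symm.trans (h.push hG).cls_eq
  rw [Fintype.sum_unique, neg_zero, T_zero, one_smul] at h1
  rw [h1, smul_smul, ← T_add, zero_add, add_neg_cancel, T_zero, one_smul, Fintype.sum_sigma,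
    Fintype.sum_unique, row_adjMatrix]
  simp only [Finset.sum_apply, Finset.sum_smul]
  rw [Finset.sum_comm]
  refine Finset.sum_congr rfl fun e _ => ?_
  rw [Finset.sum_eq_single (G.tgt e)]
  · rw [Pi.single_eq_same, one_smul]
  · intro w _ hw
    rw [Pi.single_eq_of_ne hw, zero_smul]
  · simp

theorem IsVertexBasis.exists_raise (hG : G.NoSinks) {M : GrProj (grading K G)} {N : ℤ}
    {m : ℕ} {v : Fin m → V} {q : Fin m → M.carrier} (h : IsVertexBasis M N v q) (k : ℕ) :
    ∃ (m' : ℕ) (v' : Fin m' → V) (q' : Fin m' → M.carrier), IsVertexBasis M (N + k) v' q' ∧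
      vertexCount v' = Matrix.vecMul (vertexCount v) (G.adjMatrix ^ k) := by
  induction k with
  | zero => exact ⟨m, v, q, by simpa using h, by simp⟩
  | succ k ih =>
    obtain ⟨m', v', q', h', hv'⟩ := ih
    refine ⟨_, _, _, (add_assoc N k 1 ▸ h'.push hG).reindex (Fintype.equivFin _).symm, ?_⟩
    rw [vertexCount_comp_equiv, vertexCount_push, hv', Matrix.vecMul_vecMul, ← pow_succ]

theorem exists_vertexCount_eq (m : V → ℕ) : ∃ (k : ℕ) (v : Fin k → V), vertexCount v = m := by
  refine ⟨_, Sigma.fst ∘ (Fintype.equivFin (Σ u, Fin (m u))).symm, ?_⟩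
  rw [vertexCount_comp_equiv]
  ext u
  rw [vertexCount, Fintype.sum_sigma]
  simp [Finset.sum_apply, Pi.single_apply]

/-- Equal classes become isomorphic modules after adding some `R`, which has a vertex basis of its
own. In a common degree the multiplicities agree up to a power of the adjacency matrix, and those of
`R` cancel. -/
theorem exists_vecMul_eq_of_intComb_eq (hG : G.NoSinks) {m m' : V → ℕ}
    (h : intComb (vertexClass K G) (fun u => (m u : ℤ)) =
      intComb (vertexClass K G) fun u => (m' u : ℤ)) :
    ∃ n, Matrix.vecMul m (G.adjMatrix ^ n) = Matrix.vecMul m' (G.adjMatrix ^ n) := by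
  obtain ⟨k, v, rfl⟩ := exists_vertexCount_eq m
  obtain ⟨k', v', rfl⟩ := exists_vertexCount_eq m'
  obtain ⟨M, q, hq, -⟩ := exists_isVertexBasis (K := K) (G := G) 0 v
  obtain ⟨M', q', hq', -⟩ := exists_isVertexBasis (K := K) (G := G) 0 v'
  rw [← sum_comp_eq_intComb, ← sum_comp_eq_intComb] at h
  have hM : K0gr.cls M = K0gr.cls M' := by rw [hq.cls_eq, hq'.cls_eq, h]
  obtain ⟨z, hz⟩ := K0gr.exists_add_eq_of_of_eq _ hM
  obtain ⟨R, rfl⟩ := Quotient.exists_rep z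
  obtain ⟨f, hf⟩ : (M.add R).Iso (M'.add R) := Quotient.exact hz
  obtain ⟨N, r, w, p, hp⟩ := exists_vertexBasis hG R
  -- The bases have degrees `N` and `0`; all are raised to the larger of the two.
  obtain ⟨_, w₁, p₁, hp₁, -⟩ := hp.exists_raise hG (-N).toNat
  obtain ⟨_, v₁, q₁, hq₁, hv₁⟩ := hq.exists_raise hG N.toNat
  obtain ⟨_, v₂, q₂, hq₂, hv₂⟩ := hq'.exists_raise hG N.toNat
  have hN : N + (-N).toNat = 0 + N.toNat := by omega
  rw [hN] at hp₁
  obtain ⟨n, hn⟩ := (((hq₁.add hp₁).of_iso f hf).reindex finSumFinEquiv.symm).vertexCount_eq hG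
    ((hq₂.add hp₁).reindex finSumFinEquiv.symm)
  rw [vertexCount_comp_equiv, vertexCount_comp_equiv, vertexCount_sumElim, vertexCount_sumElim,
    Matrix.add_vecMul, Matrix.add_vecMul, hv₁, hv₂, Matrix.vecMul_vecMul, Matrix.vecMul_vecMul,
    ← pow_add] at hn
  exact ⟨_, add_right_cancel hn⟩

theorem cls_mem_closure (hG : G.NoSinks) (M : GrProj (grading K G)) :
    K0gr.cls M ∈ AddSubmonoid.closure
      {x | ∃ (n : ℤ) (v : V), (T n : ℤ[T;T⁻¹]) • vertexClass K G v = x} := by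
  obtain ⟨N, n, v, q, h⟩ := exists_vertexBasis hG M
  rw [h.cls_eq, Finset.smul_sum]
  exact sum_mem fun i _ => AddSubmonoid.subset_closure ⟨_, _, rfl⟩

/-- The graded Grothendieck group of a Leavitt path algebra is the dimension group of the
adjacency matrix. -/
theorem isDimensionGroup (hG : G.NoSinks) :
    IsDimensionGroup G.adjMatrix (K0gr.cone (grading K G)) (vertexClass K G) := by
  have hcone : K0gr.cone (grading K G) = AddSubmonoid.closure
      {x | ∃ (n : ℤ) (v : V), (T n : ℤ[T;T⁻¹]) • vertexClass K G v = x} := by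
    refine le_antisymm ?_ (AddSubmonoid.closure_le.2 ?_)
    · rintro _ ⟨x, rfl⟩
      obtain ⟨M, rfl⟩ := Quotient.exists_rep x
      exact cls_mem_closure hG M
    · rintro _ ⟨n, v, rfl⟩
      exact ⟨_, K0gr.of_shift _ n _⟩
  refine ⟨dimensionRel_vertexClass hG, hcone, ?_, fun c hc => ?_⟩
  · have hle : ∀ x, K0gr.of (grading K G) x ∈
        Submodule.span ℤ[T;T⁻¹] (Set.range (vertexClass K G)) := by
      intro x
      have hx : K0gr.of (grading K G) x ∈ K0gr.cone (grading K G) := ⟨x, rfl⟩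
      rw [hcone] at hx
      refine (AddSubmonoid.closure_le (S := (Submodule.span ℤ[T;T⁻¹]
        (Set.range (vertexClass K G))).toAddSubmonoid)).2 ?_ hx
      rintro _ ⟨n, v, rfl⟩
      exact Submodule.smul_mem _ _ (Submodule.subset_span ⟨v, rfl⟩)
    refine eq_top_iff.2 fun x _ => ?_
    obtain ⟨y, z, rfl⟩ := K0gr.exists_sub _ x
    exact sub_mem (hle y) (hle z)
  -- Multiplicities are natural numbers, so `c` is split into positive and negative parts.
  · have hsub : c = (fun u => ((c u).toNat : ℤ)) - fun u => ((-c u).toNat : ℤ) := by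
      ext u
      simp only [Pi.sub_apply]
      omega
    have hc' := hc
    rw [hsub, map_sub, sub_eq_zero] at hc'
    obtain ⟨n, hn⟩ := exists_vecMul_eq_of_intComb_eq hG hc'
    refine ⟨n, ?_⟩
    have hcast : ∀ m : V → ℕ, Matrix.vecMul (fun u => (m u : ℤ))
        (G.adjMatrix.map (Nat.cast : ℕ → ℤ) ^ n) =
          fun u => ((Matrix.vecMul m (G.adjMatrix ^ n) u : ℕ) : ℤ) := by
      intro m
      have : G.adjMatrix.map (Nat.cast : ℕ → ℤ) ^ n =
          (G.adjMatrix ^ n).map (Nat.cast : ℕ → ℤ) :=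
        (map_pow (Nat.castRingHom ℤ).mapMatrix G.adjMatrix n).symm
      rw [this]
      ext u
      simp [Matrix.vecMul, dotProduct]
    rw [hsub, Matrix.sub_vecMul, hcast, hcast, hn, sub_self]

theorem isVertexBasis_regular :
    IsVertexBasis (GrProj.regular (grading K G)) 0 id (vert K G) := by
  have hs : ∀ a : V → LeavittPathAlgebra K G,
      (∑ i, op (a i) • (vert K G i : (GrProj.regular (grading K G)).carrier)) =
        ∑ i, vert K G i * a i := fun a => rfl
  have hx : ∀ x : LeavittPathAlgebra K G, x = ∑ i, vert K G i * x := fun x => by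
    rw [← Finset.sum_mul, sum_vert, one_mul]
  refine ⟨.of_exists_coeff (fun v => vert_mem K G v) (fun v => vert_mul_self K G v) fun x =>
    ⟨fun _ => x, ?_⟩, fun a ha v => ?_⟩
  · exact (hx x).trans (hs fun _ => x).symm
  · have h : ∑ i, vert K G i * a i = 0 := ha
    have h1 := congrArg (vert K G v * ·) h
    simp only [mul_zero, Finset.mul_sum, ← mul_assoc] at h1
    rw [Finset.sum_eq_single v] at h1
    · rwa [vert_mul_self] at h1
    · intro w _ hw
      rw [vert_mul_ne K G hw.symm, zero_mul]
    · simp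

theorem cls_regular :
    K0gr.cls (GrProj.regular (grading K G)) = ∑ v, vertexClass K G v := by
  rw [isVertexBasis_regular.cls_eq, neg_zero, T_zero, one_smul]
  rfl

end LeavittPathAlgebra

theorem DirGraph.NoSinks.tensor {V E W F : Type*} [DecidableEq V] [Fintype V] [Fintype E]
    [DecidableEq W] [Fintype W] [Fintype F] {G : DirGraph V E} {H : DirGraph W F}
    (hG : G.NoSinks) (hH : H.NoSinks) : (G.tensor H).NoSinks := by
  rintro ⟨v, w⟩
  obtain ⟨e, he⟩ := hG v
  obtain ⟨f, hf⟩ := hH w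
  have h₁ : 0 < G.adjMatrix v (G.tgt e) := Fintype.card_pos_iff.2 ⟨⟨e, he, rfl⟩⟩
  have h₂ : 0 < H.adjMatrix w (H.tgt f) := Fintype.card_pos_iff.2 ⟨⟨f, hf, rfl⟩⟩
  exact ⟨⟨((v, w), (G.tgt e, H.tgt f)), ⟨0, Nat.mul_pos h₁ h₂⟩⟩, rfl⟩

end

/-! ### The tensor product theorem. -/

open LeavittPathAlgebra in
theorem theorem6p2 {K V E W F : Type*} [Field K]
    [DecidableEq V] [Fintype V] [Fintype E] [DecidableEq W] [Fintype W] [Fintype F]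
    (G : DirGraph V E) (H : DirGraph W F) (hG : G.NoSinks) (hH : H.NoSinks) :
    ∃ Φ : K0gr (grading K (G.tensor H)) ≃ₗ[ℤ[T;T⁻¹]]
        DiagTensor (K0gr (grading K G)) (K0gr (grading K H)),
      (∀ z, z ∈ K0gr.cone (grading K (G.tensor H)) ↔
        Φ z ∈ DiagTensor.cone (K0gr.cone (grading K G)) (K0gr.cone (grading K H))) ∧
      Φ (K0gr.cls (GrProj.regular (grading K (G.tensor H)))) =
        DiagTensor.tmul (K0gr.cls (GrProj.regular (grading K G)))
          (K0gr.cls (GrProj.regular (grading K H))) := by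
  have h := isDimensionGroup (K := K) (hG.tensor hH)
  have hA : (G.tensor H).adjMatrix = G.adjMatrix ⊗ₖ H.adjMatrix := DirGraph.adjMatrix_ofMatrix _
  rw [hA] at h
  obtain ⟨Φ, hΦ, hb⟩ :=
    h.exists_linearEquiv ((isDimensionGroup (K := K) hG).tensor (isDimensionGroup (K := K) hH))
  refine ⟨Φ, hΦ, ?_⟩
  -- The class of each algebra is the sum of its vertex classes, and `Φ` sends the class of `(v, w)`
  -- to the tensor of those of `v` and `w`.
  rw [cls_regular, cls_regular, cls_regular, map_sum, ← diagMk_apply,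
    map_sum (diagMk (K0gr (grading K G)) (K0gr (grading K H))),
    AddMonoidHom.finsetSum_apply, Fintype.sum_prod_type]
  refine Finset.sum_congr rfl fun v _ => ?_
  rw [map_sum]
  exact Finset.sum_congr rfl fun w _ => hb (v, w)
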